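/- Let $K$ be a field of characteristic $0$ and let $(V,l)$ be a super vector space over $K$ with an even supersymmetric scalar product, given in a homogeneous basis $(e_i)_{i\in I}$ by its Gram matrix (non-degeneracy is not needed). Let $$F(V)=\mathrm{Symm}\Big(\bigoplus_{r\ge 1}\Pi\big((\Pi V)^{\otimes r}\big)_{\mathbb Z/r}\Big)$$ be the supercommutative algebra generated by the parity-shifted cyclic words $(a_1\dots a_r)^c$ in letters $a_i\in\Pi V$ (the empty word is $0$). Put $\omega(\pi x,\pi y)=(-1)^{\bar x}l(x,y)$ on $\Pi V$. Let $\Delta$ be the noncommutative Batalin–Vilkovisky operator on $F(V)$, i.e. the odd second order operator with $\Delta(1)=0$, $$\Delta\big((a_1\dots a_r)^c\big)=\sum_{p<q}\pm\,\omega(a_p,a_q)\,(a_{p+1}\dots a_{q-1})^c\,(a_{q+1}\dots a_r a_1\dots a_{p-1})^c ,$$ whose second order part on a product of two words is $$(a_1\dots a_r)^c\otimes(b_1\dots b_t)^c\mapsto\sum_{p,q}\pm\,\omega(a_p,b_q)\,(a_1\dots a_{p-1}b_{q+1}\dots b_t b_1\dots b_{q-1}a_{p+1}\dots a_r)^c ,$$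 with Koszul signs. Let $\{x,y\}=(-1)^{\bar x}\big(\Delta(xy)-\Delta(x)y-(-1)^{\bar x}x\Delta(y)\big)$. A solution of the noncommutative BV equation in $F(V)$ is an $S\in F(V)[[\hbar]]$ with $\hbar\Delta S+\tfrac12\{S,S\}=0$. Let $k,k'\ge 0$ and $(\widetilde V,\widetilde l)=(V,l)\otimes(gl(k|k'),tr)$, where $tr$ is the super trace and $\widetilde l(v\otimes A,w\otimes B)=(-1)^{\bar A\bar w}l(v,w)\,tr(AB)$. Then there is a (necessarily unique) algebra homomorphism $M:F(V)\to F(\widetilde V)$ that sends each generator to the super trace of the product of the $gl(k|k')$-valued generators $A_i$ with entries $a_i\otimes E_{\alpha\beta}$: $$M\big((a_1\dots a_r)^c\big)=tr(A_1\dots A_r)^c=\sum_{\alpha_1,\dots,\alpha_r}\pm\big((a_1\otimes E_{\alpha_r\alpha_1})(a_2\otimes E_{\alpha_1\alpha_2})\cdots(a_r\otimes E_{\alpha_{r-1}\alpha_r})\big)^c ,$$ with Koszul signs. Extend $M$ to power series in $\hbar$ coefficientwise. Then: 1. If $S$ is a solution of the noncommutative BV equation in $F(V)$, then $M(S)$ is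 a solution in $F(\widetilde V)$; if $S$ is even, so is $M(S)$. 2. A solution $T$ in $F(\widetilde V)$ is of the form $T=M(S)$ with $S$ a solution in $F(V)$ (even if $T$ is even) if and only if $T$ is $gl(k|k')$-symmetric in the following sense. For a matrix unit $X=E_{\gamma\delta}\in gl(k|k')$ adjoin to the letters of $\Pi\widetilde V$ a new letter $t$ of the parity of $X$, and let $D_X$ be the even derivation from $F(\widetilde V)$ to the algebra of cyclic words in the enlarged alphabet that replaces the letters of each cyclic word, one at a time, by the commutator $$[t\otimes X,\;a\otimes A]=(-1)^{\bar X\bar a}\,t\,(a\otimes XA)-(-1)^{\bar X}(a\otimes AX)\,t$$ (here $\bar a$ is the parity of $a\in\Pi V$). $T$ is $gl(k|k')$-symmetric if $D_X$ annihilates all $\hbar$-coefficients of $T$ for all $X$. -/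

import Mathlib

open scoped PowerSeries

namespace NCBV

/-! ### Koszul signs and cyclic words -/

/-- The sign `(-1)^e` of a parity `e ∈ ℤ/2`. -/
def sgn (K : Type*) [Field K] (e : ZMod 2) : K := if e = 0 then 1 else -1

theorem sgn_zero (K : Type*) [Field K] : sgn K 0 = 1 := by simp [sgn]

theorem sgn_add (K : Type*) [Field K] (a b : ZMod 2) : sgn K (a + b) = sgn K a * sgn K b := by
  have h : ∀ a : ZMod 2, a = 0 ∨ a = 1 := by decide
  have h11 : (1 : ZMod 2) + 1 = 0 := by decide
  rcases h a with rfl | rfl <;> rcases h b with rfl | rfl <;> simp [sgn, h11]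

theorem sgn_mul_self (K : Type*) [Field K] (a : ZMod 2) : sgn K a * sgn K a = 1 := by
  have h : ∀ a : ZMod 2, a + a = 0 := by decide
  rw [← sgn_add, h, sgn_zero]

/-- The parity of a tensor `a₁ ⊗ ⋯ ⊗ aᵣ` of homogeneous letters; `lp` gives the parities of the
letters. -/
def wp {ι : Type*} (lp : ι → ZMod 2) (w : List ι) : ZMod 2 := (w.map lp).sum

@[simp] theorem wp_nil {ι : Type*} (lp : ι → ZMod 2) : wp lp [] = 0 := rfl

@[simp] theorem wp_cons {ι : Type*} (lp : ι → ZMod 2) (a : ι) (w : List ι) :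
    wp lp (a :: w) = lp a + wp lp w := by simp [wp]

@[simp] theorem wp_append {ι : Type*} (lp : ι → ZMod 2) (u v : List ι) :
    wp lp (u ++ v) = wp lp u + wp lp v := by simp [wp]

/-- Let `W` be the super vector space with homogeneous basis `ι`, the letter `i` having parity
`lp i`. These are the relations of the free supercommutative algebra
`Symm (⨁_{r ≥ 1} Π (W^{⊗ r})_{ℤ/r})`, the free generators being lists of letters:
the empty word is no generator, the letters of a word may be rotated cyclically with the Koszul
sign, and words supercommute, the parity of a word being its parity as a tensor plus one. -/
inductive Rel (K : Type*) [Field K] {ι : Type*} (lp : ι → ZMod 2) :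
    FreeAlgebra K (List ι) → FreeAlgebra K (List ι) → Prop
  | empty : Rel K lp (FreeAlgebra.ι K []) 0
  | rot (a : ι) (u : List ι) :
      Rel K lp (FreeAlgebra.ι K (a :: u))
        (sgn K (lp a * wp lp u) • FreeAlgebra.ι K (u ++ [a]))
  | comm (u v : List ι) :
      Rel K lp (FreeAlgebra.ι K u * FreeAlgebra.ι K v)
        (sgn K ((wp lp u + 1) * (wp lp v + 1)) • (FreeAlgebra.ι K v * FreeAlgebra.ι K u))

/-- The supercommutative algebra `Symm (⨁_{r ≥ 1} Π (W^{⊗ r})_{ℤ/r})` generated by the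
parity-shifted cyclic words in the letters `ι`. -/
abbrev CycAlg (K : Type*) [Field K] {ι : Type*} (lp : ι → ZMod 2) : Type _ := RingQuot (Rel K lp)

section words

variable {K : Type*} [Field K] {ι : Type*} {lp : ι → ZMod 2}

/-- The generator given by the cyclic word `(a₁ … aᵣ)ᶜ`. -/
def word (K : Type*) [Field K] {ι : Type*} (lp : ι → ZMod 2) (w : List ι) : CycAlg K lp :=
  RingQuot.mkAlgHom K (Rel K lp) (FreeAlgebra.ι K w)

theorem word_nil : word K lp [] = 0 := by
  simpa [word] using RingQuot.mkAlgHom_rel K (Rel.empty (K := K) (lp := lp))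

theorem word_rot (a : ι) (u : List ι) :
    word K lp (a :: u) = sgn K (lp a * wp lp u) • word K lp (u ++ [a]) := by
  simpa [word] using RingQuot.mkAlgHom_rel K (Rel.rot (K := K) (lp := lp) a u)

theorem word_comm (u v : List ι) : word K lp u * word K lp v =
    sgn K ((wp lp u + 1) * (wp lp v + 1)) • (word K lp v * word K lp u) := by
  simpa [word] using RingQuot.mkAlgHom_rel K (Rel.comm (K := K) (lp := lp) u v)

theorem word_append (u v : List ι) :
    word K lp (u ++ v) = sgn K (wp lp u * wp lp v) • word K lp (v ++ u) := by
  induction u generalizing v with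
  | nil => simp [sgn_zero]
  | cons a u ih =>
    rw [List.cons_append, word_rot, List.append_assoc, ih, smul_smul, ← sgn_add]
    simp only [wp_append, wp_cons, wp_nil, List.append_assoc, List.cons_append, List.nil_append]
    congr 2
    generalize lp a = x
    generalize wp lp u = y
    generalize wp lp v = z
    revert x y z
    decide

/-- The super cyclic symmetrisation `∑ᵢ ± f (aᵢ₊₁ … aᵣ a₁ … aᵢ)` over all rotations of a word. -/
def rotSum {A : Type*} [AddCommGroup A] [Module K A] (lp : ι → ZMod 2) (f : List ι → A)
    (w : List ι) : A :=
  ∑ i ∈ Finset.range w.length,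
    sgn K (wp lp (w.take i) * wp lp (w.drop i)) • f (w.drop i ++ w.take i)

theorem wp_take_add_drop (lp : ι → ZMod 2) (w : List ι) (i : ℕ) :
    wp lp (w.take i) + wp lp (w.drop i) = wp lp w := by
  rw [← wp_append, List.take_append_drop]

theorem rotSum_rot {A : Type*} [AddCommGroup A] [Module K A] (f : List ι → A)
    (a : ι) (u : List ι) :
    rotSum (K := K) lp f (a :: u) =
      sgn K (lp a * wp lp u) • rotSum (K := K) lp f (u ++ [a]) := by
  simp only [rotSum, List.length_cons, List.length_append, List.length_nil, zero_add]
  rw [Finset.sum_range_succ', Finset.sum_range_succ, smul_add, Finset.smul_sum]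
  congr 1
  · refine Finset.sum_congr rfl fun i hi => ?_
    have hi' : i ≤ u.length := (Finset.mem_range.1 hi).le
    rw [List.drop_append_of_le_length hi', List.take_append_of_le_length hi', smul_smul,
      ← sgn_add]
    simp only [List.drop_succ_cons, List.take_succ_cons, List.append_assoc, List.cons_append,
      List.nil_append, wp_cons, wp_append, wp_nil]
    rw [← wp_take_add_drop lp u i]
    congr 2
    generalize lp a = x
    generalize wp lp (u.take i) = y
    generalize wp lp (u.drop i) = z
    revert x y z
    decide
  · simp only [List.take_zero, List.drop_zero, wp_nil, zero_mul, sgn_zero, one_smul,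
      List.append_nil, List.take_left, List.drop_left, smul_smul, wp_cons, List.cons_append,
      List.nil_append, add_zero]
    rw [mul_comm (wp lp u), sgn_mul_self, one_smul]

theorem rotSum_congr {A : Type*} [AddCommGroup A] [Module K A] {f g : List ι → A}
    {w : List ι} (h : ∀ v, wp lp v = wp lp w → f v = g v) :
    rotSum (K := K) lp f w = rotSum (K := K) lp g w := by
  refine Finset.sum_congr rfl fun i _ => ?_
  rw [h]
  rw [wp_append, add_comm, wp_take_add_drop]

theorem rotSum_map {A B : Type*} [AddCommGroup A] [Module K A] [AddCommGroup B] [Module K B]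
    (T : A →ₗ[K] B) (f : List ι → A) (w : List ι) :
    T (rotSum (K := K) lp f w) = rotSum (K := K) lp (fun v => T (f v)) w := by
  simp [rotSum]

theorem rotSum_smul {A : Type*} [AddCommGroup A] [Module K A] (c : K) (f : List ι → A)
    (w : List ι) :
    rotSum (K := K) lp (fun v => c • f v) w = c • rotSum (K := K) lp f w := by
  simp only [rotSum, Finset.smul_sum]
  exact Finset.sum_congr rfl fun i _ => smul_comm _ _ _

theorem rotSum_comm {A : Type*} [AddCommGroup A] [Module K A] (f : List ι → List ι → A)
    (u v : List ι) :
    rotSum (K := K) lp (fun x => rotSum (K := K) lp (f x) v) u =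
      rotSum (K := K) lp (fun y => rotSum (K := K) lp (fun x => f x y) u) v := by
  simp only [rotSum, Finset.smul_sum]
  rw [Finset.sum_comm]
  exact Finset.sum_congr rfl fun i _ => Finset.sum_congr rfl fun j _ => smul_comm _ _ _

/-! ### Operators on the algebra of cyclic words that are determined by their values on words -/

/-- Elements of the subspace spanned by elements that supercommute with words as an element of
parity `e` does. -/
def HasPar (e : ZMod 2) (x : CycAlg K lp) : Prop :=
  ∀ v : List ι, x * word K lp v = sgn K (e * (wp lp v + 1)) • (word K lp v * x)

theorem HasPar.zero (e : ZMod 2) : HasPar e (0 : CycAlg K lp) := by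
  intro v; simp

theorem HasPar.add {e : ZMod 2} {x y : CycAlg K lp} (hx : HasPar e x) (hy : HasPar e y) :
    HasPar e (x + y) := by
  intro v; rw [add_mul x y, hx, hy, mul_add _ x y, smul_add]

theorem HasPar.smul {e : ZMod 2} {x : CycAlg K lp} (c : K) (hx : HasPar e x) :
    HasPar e (c • x) := by
  intro v; rw [smul_mul_assoc, hx, mul_smul_comm, smul_comm]

theorem HasPar.sum {e : ZMod 2} {α : Type*} (s : Finset α) (f : α → CycAlg K lp)
    (h : ∀ i ∈ s, HasPar e (f i)) : HasPar e (∑ i ∈ s, f i) := by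
  classical
  induction s using Finset.induction_on with
  | empty => simpa using HasPar.zero e
  | insert a s ha ih =>
    rw [Finset.sum_insert ha]
    exact (h a (by simp)).add (ih fun i hi => h i (by simp [hi]))

theorem HasPar.word (w : List ι) : HasPar (wp lp w + 1) (word K lp w) := fun v => word_comm w v

theorem HasPar.mul {d e : ZMod 2} {x y : CycAlg K lp} (hx : HasPar d x) (hy : HasPar e y) :
    HasPar (d + e) (x * y) := by
  intro v
  rw [mul_assoc, hy, mul_smul_comm, ← mul_assoc, hx, smul_mul_assoc, smul_smul, add_mul, sgn_add,
    mul_comm (sgn K (d * _)), mul_assoc]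

theorem HasPar.rotSum {e : ZMod 2} {f : List ι → CycAlg K lp} {w : List ι}
    (h : ∀ v, wp lp v = wp lp w → HasPar e (f v)) : HasPar e (rotSum (K := K) lp f w) := by
  refine HasPar.sum _ _ fun i _ => HasPar.smul _ (h _ ?_)
  rw [wp_append, add_comm, wp_take_add_drop]

/-- The operator `(y, z) ↦ (g y, d y + s g z + J y)`. -/
def stepOp {A : Type*} [Ring A] [Algebra K A] (g d : A) (s : K) (J : A →ₗ[K] A) :
    Module.End K (A × A) :=
  LinearMap.prod
    (LinearMap.mulLeft K g ∘ₗ LinearMap.fst K A A)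
    ((LinearMap.mulLeft K d + J) ∘ₗ LinearMap.fst K A A
      + s • (LinearMap.mulLeft K g ∘ₗ LinearMap.snd K A A))

@[simp] theorem stepOp_apply {A : Type*} [Ring A] [Algebra K A] (g d : A) (s : K) (J : A →ₗ[K] A)
    (p : A × A) : stepOp g d s J p = (g * p.1, d * p.1 + J p.1 + s • (g * p.2)) := rfl

/-- The unique linear map `T` with `T 1 = 0` and
`T (w · y) = d w · φ y + J w (φ y) + s w • (φ w · T y)` for all words `w`, where `φ` is the algebra
map that sends every word `w` to `g w`. -/
def recOp {A : Type*} [Ring A] [Algebra K A] (g d : List ι → A) (s : List ι → K)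
    (J : List ι → A →ₗ[K] A)
    (h : ∀ ⦃x y : FreeAlgebra K (List ι)⦄, Rel K lp x y →
      FreeAlgebra.lift K (fun w => stepOp (g w) (d w) (s w) (J w)) x =
        FreeAlgebra.lift K (fun w => stepOp (g w) (d w) (s w) (J w)) y) :
    CycAlg K lp →ₗ[K] A :=
  LinearMap.snd K A A ∘ₗ LinearMap.applyₗ ((1, 0) : A × A) ∘ₗ
    (RingQuot.liftAlgHom K
      ⟨FreeAlgebra.lift K (fun w => stepOp (g w) (d w) (s w) (J w)), h⟩).toLinearMap

theorem recOp_rel {A : Type*} [Ring A] [Algebra K A] (g d : List ι → A) (s : List ι → K)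
    (J : List ι → A →ₗ[K] A)
    (hg0 : g [] = 0) (hd0 : d [] = 0) (hJ0 : ∀ y, J [] y = 0)
    (hg : ∀ a u, g (a :: u) = sgn K (lp a * wp lp u) • g (u ++ [a]))
    (hd : ∀ a u, d (a :: u) = sgn K (lp a * wp lp u) • d (u ++ [a]))
    (hJ : ∀ a u y, J (a :: u) y = sgn K (lp a * wp lp u) • J (u ++ [a]) y)
    (hs : ∀ a u, s (a :: u) = s (u ++ [a]))
    (hgg : ∀ u v, g u * g v = sgn K ((wp lp u + 1) * (wp lp v + 1)) • (g v * g u))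
    (hdd : ∀ u v y, d u * (g v * y) + J u (g v * y) + s u • (g u * (d v * y + J v y)) =
      sgn K ((wp lp u + 1) * (wp lp v + 1)) •
        (d v * (g u * y) + J v (g u * y) + s v • (g v * (d u * y + J u y))))
    ⦃x y : FreeAlgebra K (List ι)⦄ (h : Rel K lp x y) :
    FreeAlgebra.lift K (fun w => stepOp (g w) (d w) (s w) (J w)) x =
      FreeAlgebra.lift K (fun w => stepOp (g w) (d w) (s w) (J w)) y := by
  refine LinearMap.ext fun p => ?_
  induction h with
  | empty => simp [hg0, hd0, hJ0]
  | rot a u =>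
    simp only [FreeAlgebra.lift_ι_apply, map_smul, LinearMap.smul_apply, stepOp_apply,
      Prod.smul_mk, smul_add]
    rw [hg a u, hd a u, hJ a u, hs a u, smul_mul_assoc, smul_mul_assoc, smul_mul_assoc,
      smul_comm (s (u ++ [a]))]
  | comm u v =>
    simp only [FreeAlgebra.lift_ι_apply, map_mul, map_smul, LinearMap.smul_apply,
      Module.End.mul_apply, stepOp_apply, Prod.smul_mk]
    refine Prod.ext ?_ ?_
    · simp only
      rw [← mul_assoc, hgg, smul_mul_assoc, mul_assoc]
    · simp only
      rw [mul_add (g u), smul_add (s u), ← add_assoc, hdd, mul_add (g v) (d u * p.1 + J u p.1),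
        smul_add (s v), ← add_assoc (d v * (g u * p.1) + J v (g u * p.1)),
        smul_add (sgn K _) (_ + _ + _)]
      congr 1
      rw [mul_smul_comm, mul_smul_comm, ← mul_assoc, ← mul_assoc, hgg, smul_mul_assoc,
        smul_comm (s v) (sgn K _), smul_comm (s u) (sgn K _), smul_comm (s u) (s v)]

theorem recOp_one {A : Type*} [Ring A] [Algebra K A] (g d : List ι → A) (s : List ι → K)
    (J : List ι → A →ₗ[K] A) (h) : recOp (lp := lp) g d s J h 1 = 0 := by
  simp [recOp]

theorem recOp_mul {A : Type*} [Ring A] [Algebra K A] (g d : List ι → A) (s : List ι → K)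
    (J : List ι → A →ₗ[K] A) (h) (φ : CycAlg K lp →ₐ[K] A) (hφ : ∀ w, φ (word K lp w) = g w)
    (w : List ι) (y : CycAlg K lp) :
    recOp g d s J h (word K lp w * y) =
      d w * φ y + J w (φ y) + s w • (g w * recOp g d s J h y) := by
  have key : ∀ (x : FreeAlgebra K (List ι)) (p : A × A),
      (FreeAlgebra.lift K (fun w => stepOp (g w) (d w) (s w) (J w)) x p).1 =
        φ (RingQuot.mkAlgHom K (Rel K lp) x) * p.1 := by
    intro x
    induction x using FreeAlgebra.induction with
    | grade0 r => intro p; simp [Algebra.smul_def]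
    | grade1 w => intro p; simp [← hφ, word]
    | mul a b ha hb => intro p; simp [ha, hb, mul_assoc]
    | add a b ha hb => intro p; simp [ha, hb, add_mul]
  obtain ⟨x, rfl⟩ := RingQuot.mkAlgHom_surjective K (Rel K lp) y
  have k1 := key x (1, 0)
  rw [mul_one] at k1
  simp only [recOp, word, LinearMap.comp_apply, AlgHom.toLinearMap_apply, map_mul,
    RingQuot.liftAlgHom_mkAlgHom_apply, LinearMap.applyₗ_apply_apply, FreeAlgebra.lift_ι_apply,
    Module.End.mul_apply, stepOp_apply, LinearMap.snd_apply, k1]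

/-- The parity involution `x ↦ (-1)^{|x|} x`, an algebra automorphism. -/
def parityInv (K : Type*) [Field K] {ι : Type*} (lp : ι → ZMod 2) :
    CycAlg K lp →ₐ[K] CycAlg K lp :=
  RingQuot.liftAlgHom K
    ⟨FreeAlgebra.lift K fun w => sgn K (wp lp w + 1) • word K lp w, by
      intro x y h
      induction h with
      | empty => simp [word_nil]
      | rot a u =>
        simp only [FreeAlgebra.lift_ι_apply, map_smul, wp_cons, wp_append, wp_nil]
        rw [word_rot a u, smul_comm, add_zero, add_comm (wp lp u)]
      | comm u v =>
        simp only [FreeAlgebra.lift_ι_apply, map_mul, map_smul, smul_mul_smul_comm]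
        rw [word_comm u v, smul_comm, mul_comm (sgn K (wp lp u + 1))]⟩

end words

/-! ### Super vector spaces with an even scalar product -/

/-- A super vector space `(V, l)` with an even supersymmetric scalar product, written in a
homogeneous basis `ι`: `parity i` is the parity of the basis vector `e_i`, and
`form i j = l (e_i, e_j)`. -/
structure EvenScalarSpace (K : Type*) [Field K] (ι : Type*) where
  parity : ι → ZMod 2
  form : ι → ι → K
  form_even : ∀ i j, parity i ≠ parity j → form i j = 0
  form_symm : ∀ i j, form i j = sgn K (parity i * parity j) * form j i

namespace EvenScalarSpace

variable {K : Type*} [Field K] {ι : Type*}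

/-- The parity of the letter `π e_i` of `Π V`. -/
def letter (V : EvenScalarSpace K ι) (i : ι) : ZMod 2 := V.parity i + 1

/-- The algebra `F(V) = Symm (⨁_{r ≥ 1} Π ((Π V)^{⊗ r})_{ℤ/r})`. -/
abbrev F (V : EvenScalarSpace K ι) : Type _ := CycAlg K V.letter

/-- The cyclic word `(π e_{a₁} … π e_{aᵣ})ᶜ` as a generator of `F(V)`. -/
abbrev cword (V : EvenScalarSpace K ι) (w : List ι) : V.F := word K V.letter w

/-- The even symplectic form `ω (π x, π y) = (-1)^{|x|} l (x, y)` on `Π V`. -/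
def omega (V : EvenScalarSpace K ι) (a b : ι) : K := sgn K (V.parity a) * V.form a b

theorem omega_even (V : EvenScalarSpace K ι) {a b : ι} (h : V.letter a ≠ V.letter b) :
    V.omega a b = 0 := by
  rw [omega, V.form_even a b (fun h' => h (by simp [letter, h'])), mul_zero]

theorem omega_symm (V : EvenScalarSpace K ι) (a b : ι) :
    V.omega a b = sgn K (V.letter a + 1 + V.letter a * V.letter b + V.letter a) * V.omega b a := by
  by_cases h : V.parity a = V.parity b
  · rw [omega, omega, V.form_symm a b, ← mul_assoc, ← mul_assoc, ← sgn_add, ← sgn_add]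
    congr 2
    simp only [letter, h]
    generalize V.parity b = x
    revert x
    decide
  · rw [omega, omega, V.form_even a b h, V.form_even b a (Ne.symm h), mul_zero, mul_zero, mul_zero]

/-- Gluing of `a x` and `b y` by contracting their first letters: `± ω(a, b) (x y)ᶜ`. The sign
comes from moving `a` to the end of the first word and from passing the parity shift of the second
word through the first word. -/
def glueHead (V : EvenScalarSpace K ι) : List ι → List ι → V.F
  | a :: x, b :: y =>
      (sgn K (V.letter a * wp V.letter x + (V.letter a + wp V.letter x)) * V.omega a b) •
        V.cword (x ++ y)
  | _, _ => 0

/-- The gluing of two cyclic words: the sum over all ways to contract a letter of `u` with a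
letter of `v`,
`(a₁ … aᵣ)ᶜ (b₁ … bₜ)ᶜ ↦ ∑_{p,q} ± ω(a_p, b_q) (a₁ … a_{p-1} b_{q+1} … b_{q-1} a_{p+1} … aᵣ)ᶜ`. -/
def glue (V : EvenScalarSpace K ι) (u v : List ι) : V.F :=
  rotSum (K := K) V.letter (fun x => rotSum (K := K) V.letter (fun y => V.glueHead x y) v) u

/-- Dissection of a word at its first letter `a` and any other letter `b`:
`a x₁ b x₂ ↦ ∑ ± ω(a, b) (x₁)ᶜ (x₂)ᶜ`. The sign comes from moving `b` next to `a` and from passing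
one parity shift through `x₁`. -/
def cutHead (V : EvenScalarSpace K ι) : List ι → V.F
  | [] => 0
  | a :: x => ∑ i : Fin x.length,
      (sgn K (wp V.letter (x.take i) * V.letter (x.get i) + wp V.letter (x.take i)) *
          V.omega a (x.get i)) •
        (V.cword (x.take i) * V.cword (x.drop (i + 1)))

/-- The dissection of a cyclic word: the sum over all unordered pairs of letters that are
contracted,
`(a₁ … aᵣ)ᶜ ↦ ∑_{p<q} ± ω(a_p, a_q) (a_{p+1} … a_{q-1})ᶜ (a_{q+1} … a_{p-1})ᶜ`
(every unordered pair occurs twice in the sum over rotations; contractions of neighbours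
contribute zero, as the empty word is zero). -/
def cut (V : EvenScalarSpace K ι) (w : List ι) : V.F :=
  (2⁻¹ : K) • rotSum (K := K) V.letter (fun x => V.cutHead x) w

theorem glue_nil_right (V : EvenScalarSpace K ι) (u : List ι) : V.glue u [] = 0 := by
  simp [glue, rotSum]

theorem glueHead_symm (V : EvenScalarSpace K ι) (u v : List ι) :
    V.glueHead u v =
      sgn K ((wp V.letter u + 1) * (wp V.letter v + 1)) • V.glueHead v u := by
  cases u with
  | nil => cases v <;> simp [glueHead]
  | cons a x =>
    cases v with
    | nil => simp [glueHead]
    | cons b y =>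
      by_cases h : V.letter a = V.letter b
      · simp only [glueHead, cword]
        rw [word_append x y, V.omega_symm a b, smul_smul, smul_smul, mul_right_comm, ← mul_assoc,
          ← mul_assoc, ← sgn_add, ← sgn_add, ← sgn_add]
        congr 3
        simp only [wp_cons, h]
        generalize V.letter b = p
        generalize wp V.letter x = q
        generalize wp V.letter y = r
        revert p q r
        decide
      · simp [glueHead, V.omega_even h, V.omega_even (Ne.symm h)]

theorem glue_symm (V : EvenScalarSpace K ι) (u v : List ι) :
    V.glue u v = sgn K ((wp V.letter u + 1) * (wp V.letter v + 1)) • V.glue v u := by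
  rw [glue, glue, rotSum_comm, ← rotSum_smul]
  refine rotSum_congr fun y hy => ?_
  rw [← rotSum_smul]
  refine rotSum_congr fun x hx => ?_
  rw [glueHead_symm, hx, hy]

theorem glue_rot_right (V : EvenScalarSpace K ι) (u : List ι) (a : ι) (v : List ι) :
    V.glue u (a :: v) = sgn K (V.letter a * wp V.letter v) • V.glue u (v ++ [a]) := by
  rw [glue, glue, rotSum_comm, rotSum_comm (v := v ++ [a]), rotSum_rot]

theorem glue_rot_left (V : EvenScalarSpace K ι) (a : ι) (u v : List ι) :
    V.glue (a :: u) v = sgn K (V.letter a * wp V.letter u) • V.glue (u ++ [a]) v := by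
  rw [glue, glue, rotSum_rot]

theorem glue_hasPar (V : EvenScalarSpace K ι) (u v : List ι) :
    HasPar (wp V.letter u + wp V.letter v + 1) (V.glue u v) := by
  refine HasPar.rotSum fun x hx => HasPar.rotSum fun y hy => ?_
  rw [← hx, ← hy]
  cases x with
  | nil => simpa [glueHead] using HasPar.zero _
  | cons a x =>
    cases y with
    | nil => simpa [glueHead] using HasPar.zero _
    | cons b y =>
      by_cases h : V.letter a = V.letter b
      · have h1 := (HasPar.word (K := K) (lp := V.letter) (x ++ y)).smul
          (sgn K (V.letter a * wp V.letter x + (V.letter a + wp V.letter x)) * V.omega a b)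
        have h2 : wp V.letter (x ++ y) + 1 =
            wp V.letter (a :: x) + wp V.letter (b :: y) + 1 := by
          simp only [wp_append, wp_cons, h]
          generalize V.letter b = p
          generalize wp V.letter x = q
          generalize wp V.letter y = r
          revert p q r
          decide
        rw [h2] at h1
        exact h1
      · simpa [glueHead, V.omega_even h] using HasPar.zero _

theorem cut_hasPar (V : EvenScalarSpace K ι) (w : List ι) :
    HasPar (wp V.letter w) (V.cut w) := by
  refine HasPar.smul _ (HasPar.rotSum fun x hx => ?_)
  rw [← hx]
  cases x with
  | nil => simpa [cutHead] using HasPar.zero _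
  | cons a x =>
    refine HasPar.sum _ _ fun i _ => ?_
    by_cases h : V.letter a = V.letter (x.get i)
    · have h1 := ((HasPar.word (K := K) (lp := V.letter) (x.take i)).mul
        (HasPar.word (K := K) (lp := V.letter) (x.drop (i + 1)))).smul
        (sgn K (wp V.letter (x.take i) * V.letter (x.get i) + wp V.letter (x.take i)) *
          V.omega a (x.get i))
      have h3 : wp V.letter x = wp V.letter (x.take i) +
          (V.letter (x.get i) + wp V.letter (x.drop (i + 1))) := by
        rw [← wp_take_add_drop V.letter x i, List.drop_eq_getElem_cons i.2, wp_cons]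
        rfl
      have h2 : wp V.letter (x.take i) + 1 + (wp V.letter (x.drop (i + 1)) + 1) =
          wp V.letter (a :: x) := by
        rw [wp_cons, h3, h]
        generalize V.letter (x.get i) = p
        generalize wp V.letter (x.take i) = q
        generalize wp V.letter (x.drop (i + 1)) = r
        revert p q r
        decide
      rw [h2] at h1
      exact h1
    · rw [V.omega_even h, mul_zero, zero_smul]
      exact HasPar.zero _

/-- The superderivation `y ↦ glue (u, y)` of `F(V)`, of the parity of the tensor `u`. -/
def glueOp (V : EvenScalarSpace K ι) (u : List ι) : V.F →ₗ[K] V.F :=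
  recOp (fun w => V.cword w) (fun w => V.glue u w)
    (fun w => sgn K (wp V.letter u * (wp V.letter w + 1))) (fun _ => 0) <| by
    refine recOp_rel _ _ _ _ word_nil (V.glue_nil_right u) (fun _ => rfl) word_rot
      (V.glue_rot_right u) (fun _ _ _ => by simp) (fun a x => ?_) word_comm (fun x v y => ?_)
    · simp [add_comm]
    · have h1 : V.glue u x * (V.cword v * y) =
          sgn K ((wp V.letter u + wp V.letter x + 1) * (wp V.letter v + 1)) •
            (V.cword v * (V.glue u x * y)) := by
        rw [← mul_assoc, V.glue_hasPar u x v, smul_mul_assoc, mul_assoc]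
      have h2 : V.glue u v * (V.cword x * y) =
          sgn K ((wp V.letter u + wp V.letter v + 1) * (wp V.letter x + 1)) •
            (V.cword x * (V.glue u v * y)) := by
        rw [← mul_assoc, V.glue_hasPar u v x, smul_mul_assoc, mul_assoc]
      simp only [LinearMap.zero_apply, add_zero]
      rw [h1, h2, smul_add, smul_smul, smul_smul, ← sgn_add, ← sgn_add, add_comm]
      congr 3
      all_goals
        generalize wp V.letter u = p
        generalize wp V.letter x = q
        generalize wp V.letter v = r
        revert p q r
        decide

theorem glueOp_one (V : EvenScalarSpace K ι) (u : List ι) : V.glueOp u 1 = 0 := recOp_one ..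

theorem glueOp_word_mul (V : EvenScalarSpace K ι) (u w : List ι) (y : V.F) :
    V.glueOp u (V.cword w * y) = V.glue u w * y +
      sgn K (wp V.letter u * (wp V.letter w + 1)) • (V.cword w * V.glueOp u y) := by
  refine (recOp_mul _ _ _ _ _ (AlgHom.id K V.F) (fun _ => rfl) w y).trans ?_
  rw [LinearMap.zero_apply, add_zero]
  rfl

theorem induction_words {lp : ι → ZMod 2} {P : CycAlg K lp → Prop} (one : P 1)
    (smul : ∀ (c : K) x, P x → P (c • x)) (add : ∀ x y, P x → P y → P (x + y))
    (mul : ∀ w x, P x → P (word K lp w * x)) (x : CycAlg K lp) : P x := by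
  obtain ⟨x, rfl⟩ := RingQuot.mkAlgHom_surjective K (Rel K lp) x
  suffices h : ∀ y, P y → P (RingQuot.mkAlgHom K (Rel K lp) x * y) by
    simpa using h 1 one
  induction x using FreeAlgebra.induction with
  | grade0 r => intro y hy; simpa [← Algebra.smul_def] using smul r y hy
  | grade1 w => intro y hy; exact mul w y hy
  | mul a b ha hb => intro y hy; rw [map_mul, mul_assoc]; exact ha _ (hb _ hy)
  | add a b ha hb => intro y hy; rw [map_add, add_mul]; exact add _ _ (ha _ hy) (hb _ hy)

theorem glueOp_nil (V : EvenScalarSpace K ι) (y : V.F) : V.glueOp [] y = 0 := by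
  induction y using induction_words with
  | one => exact V.glueOp_one []
  | smul c x hx => rw [map_smul, hx, smul_zero]
  | add x y hx hy => rw [map_add, hx, hy, add_zero]
  | mul w x hx =>
    rw [← cword, glueOp_word_mul, hx]
    simp [glue, rotSum]

theorem glueOp_rot (V : EvenScalarSpace K ι) (a : ι) (u : List ι) (y : V.F) :
    V.glueOp (a :: u) y = sgn K (V.letter a * wp V.letter u) • V.glueOp (u ++ [a]) y := by
  induction y using induction_words with
  | one => rw [glueOp_one, glueOp_one, smul_zero]
  | smul c x hx => rw [map_smul, hx, map_smul, smul_comm]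
  | add x y hx hy => rw [map_add, hx, hy, map_add, smul_add]
  | mul w x hx =>
    rw [← cword, glueOp_word_mul, hx, glueOp_word_mul, glue_rot_left, smul_add, smul_mul_assoc,
      mul_smul_comm, smul_comm (sgn K (wp V.letter (a :: u) * _))]
    simp [add_comm]

theorem cut_rot (V : EvenScalarSpace K ι) (a : ι) (u : List ι) :
    V.cut (a :: u) = sgn K (V.letter a * wp V.letter u) • V.cut (u ++ [a]) := by
  rw [cut, cut, rotSum_rot, smul_comm]

/-- The noncommutative Batalin–Vilkovisky operator: the second order operator with `Δ 1 = 0`, whose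
value on a word is its dissection, and whose second order part is the gluing of words:
`Δ (w · y) = cut w · y + glue (w, y) + (-1)^{|w|} w · Δ y`. -/
def bv (V : EvenScalarSpace K ι) : V.F →ₗ[K] V.F :=
  recOp (fun w => V.cword w) (fun w => V.cut w) (fun w => sgn K (wp V.letter w + 1))
    (fun w => V.glueOp w) <| by
    refine recOp_rel _ _ _ _ word_nil (by simp [cut, rotSum]) V.glueOp_nil word_rot
      V.cut_rot V.glueOp_rot (fun a x => ?_) word_comm (fun u v y => ?_)
    · simp [add_comm]
    · have h1 : V.cut u * (V.cword v * y) =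
          sgn K (wp V.letter u * (wp V.letter v + 1)) • (V.cword v * (V.cut u * y)) := by
        rw [← mul_assoc, V.cut_hasPar u v, smul_mul_assoc, mul_assoc]
      have h2 : V.cut v * (V.cword u * y) =
          sgn K (wp V.letter v * (wp V.letter u + 1)) • (V.cword u * (V.cut v * y)) := by
        rw [← mul_assoc, V.cut_hasPar v u, smul_mul_assoc, mul_assoc]
      have e1 : sgn K (wp V.letter u * (wp V.letter v + 1)) =
          sgn K ((wp V.letter u + 1) * (wp V.letter v + 1)) * sgn K (wp V.letter v + 1) := by
        rw [← sgn_add]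
        congr 1
        generalize wp V.letter u = p
        generalize wp V.letter v = q
        revert p q
        decide
      have e2 : sgn K (wp V.letter u + 1) =
          sgn K ((wp V.letter u + 1) * (wp V.letter v + 1)) *
            sgn K (wp V.letter v * (wp V.letter u + 1)) := by
        rw [← sgn_add]
        congr 1
        generalize wp V.letter u = p
        generalize wp V.letter v = q
        revert p q
        decide
      rw [h1, h2, glueOp_word_mul, glueOp_word_mul, V.glue_symm u v, e1, e2]
      simp only [mul_add, smul_add, mul_smul, smul_mul_assoc]
      abel

theorem bv_one (V : EvenScalarSpace K ι) : V.bv 1 = 0 := recOp_one ..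

theorem bv_word_mul (V : EvenScalarSpace K ι) (w : List ι) (y : V.F) :
    V.bv (V.cword w * y) = V.cut w * y + V.glueOp w y +
      sgn K (wp V.letter w + 1) • (V.cword w * V.bv y) := by
  exact recOp_mul _ _ _ _ _ (AlgHom.id K V.F) (fun _ => rfl) w y

/-- The Batalin–Vilkovisky bracket, the deviation of `Δ` from being a derivation:
`{x, y} = (-1)^{|x|} (Δ(x y) - Δ(x) y - (-1)^{|x|} x Δ(y))`. -/
def bracket (V : EvenScalarSpace K ι) (x y : V.F) : V.F :=
  V.bv (parityInv K V.letter x * y) - V.bv (parityInv K V.letter x) * y - x * V.bv y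

/-- `Δ` on formal power series in `ħ`. -/
noncomputable def bvSeries (V : EvenScalarSpace K ι) (S : V.F⟦X⟧) : V.F⟦X⟧ :=
  PowerSeries.mk fun n => V.bv (PowerSeries.coeff n S)

/-- The bracket on formal power series in `ħ`. -/
noncomputable def bracketSeries (V : EvenScalarSpace K ι) (S T : V.F⟦X⟧) : V.F⟦X⟧ :=
  PowerSeries.mk fun n => ∑ p ∈ Finset.HasAntidiagonal.antidiagonal n,
    V.bracket (PowerSeries.coeff p.1 S) (PowerSeries.coeff p.2 T)

/-- The noncommutative Batalin–Vilkovisky (quantum master) equation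
`ħ Δ S + ½ {S, S} = 0` for `S ∈ F(V)[[ħ]]`. -/
def IsSolution (V : EvenScalarSpace K ι) (S : V.F⟦X⟧) : Prop :=
  PowerSeries.X * V.bvSeries S + (2⁻¹ : K) • V.bracketSeries S S = 0

/-- `S ∈ F(V)[[ħ]]` is an even element. -/
def IsEven (V : EvenScalarSpace K ι) (S : V.F⟦X⟧) : Prop :=
  ∀ n, parityInv K V.letter (PowerSeries.coeff n S) = PowerSeries.coeff n S

/-! ### Tensor product with `gl(k|k')` -/

/-- The parity of the standard basis vectors of the super vector space of dimension `(k|k')`. -/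
def glPar {k k' : ℕ} : Fin k ⊕ Fin k' → ZMod 2 := Sum.elim (fun _ => 0) (fun _ => 1)

/-- The super trace on `gl(k|k')`. -/
def superTrace {k k' : ℕ} (A : Matrix (Fin k ⊕ Fin k') (Fin k ⊕ Fin k') K) : K :=
  ∑ α, sgn K (glPar α) * A α α

theorem superTrace_single_mul_single {k k' : ℕ} (α β γ δ : Fin k ⊕ Fin k') :
    superTrace (Matrix.single α β (1 : K) * Matrix.single γ δ 1) =
      if β = γ ∧ α = δ then sgn K (glPar α) else 0 := by
  by_cases h : β = γ
  · subst h
    by_cases h' : α = δ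
    · subst h'
      simp [superTrace, Matrix.single_apply]
    · simp only [superTrace, Matrix.single_mul_single_same, mul_one, h', and_false, if_false]
      refine Finset.sum_eq_zero fun x _ => ?_
      rw [Matrix.single_apply, if_neg, mul_zero]
      rintro ⟨rfl, rfl⟩
      exact h' rfl
  · simp [superTrace, Matrix.single_mul_single_of_ne, h]

/-- `(V, l) ⊗ (gl(k|k'), tr)`, in the homogeneous basis `e_i ⊗ E_{αβ}` indexed by `(i, α, β)`, with
the form `(v ⊗ A, w ⊗ B) ↦ (-1)^{|A||w|} l(v, w) tr(A B)`. -/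
def tensorGL (V : EvenScalarSpace K ι) (k k' : ℕ) :
    EvenScalarSpace K (ι × (Fin k ⊕ Fin k') × (Fin k ⊕ Fin k')) where
  parity x := V.parity x.1 + (glPar x.2.1 + glPar x.2.2)
  form x y := sgn K ((glPar x.2.1 + glPar x.2.2) * V.parity y.1) * V.form x.1 y.1 *
    superTrace (Matrix.single x.2.1 x.2.2 (1 : K) * Matrix.single y.2.1 y.2.2 1)
  form_even := by
    rintro ⟨i, α, β⟩ ⟨j, γ, δ⟩ h
    simp only [superTrace_single_mul_single] at h ⊢
    split_ifs with h'
    · obtain ⟨rfl, rfl⟩ := h'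
      rw [V.form_even i j, mul_zero, zero_mul]
      intro hij
      exact h (by rw [hij, add_comm (glPar α)])
    · rw [mul_zero]
  form_symm := by
    rintro ⟨i, α, β⟩ ⟨j, γ, δ⟩
    simp only [superTrace_single_mul_single]
    by_cases h' : β = γ ∧ α = δ
    · obtain ⟨rfl, rfl⟩ := h'
      by_cases hij : V.parity i = V.parity j
      · rw [V.form_symm i j, hij]
        simp only [and_self, if_true]
        have key : ∀ p q r : ZMod 2, sgn K ((p + q) * r) * sgn K (r * r) * sgn K p =
            sgn K ((r + (p + q)) * (r + (q + p))) * sgn K ((q + p) * r) * sgn K q := by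
          intro p q r
          rw [← sgn_add, ← sgn_add, ← sgn_add, ← sgn_add]
          congr 1
          revert p q r
          decide
        linear_combination V.form j i * key (glPar α) (glPar β) (V.parity j)
      · rw [V.form_even i j hij, V.form_even j i (Ne.symm hij)]
        simp
    · have h'' : ¬(δ = α ∧ γ = β) := fun h => h' ⟨h.2.symm, h.1.symm⟩
      rw [if_neg h', if_neg h'', mul_zero, mul_zero, mul_zero]

/-- The trace `tr (A₁ … Aᵣ)ᶜ` of a cyclic word `(a₁ … aᵣ)ᶜ`, where `Aᵢ` is the `gl(k|k')`-valued
generator with entries `aᵢ ⊗ E_{αβ}`: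
`∑_{α₁, …, αᵣ} ± ((a₁ ⊗ E_{αᵣα₁}) (a₂ ⊗ E_{α₁α₂}) … (aᵣ ⊗ E_{αᵣ₋₁αᵣ}))ᶜ`.
The sign is the Koszul sign: `αᵢ` contributes for `i < r`, as the super trace over the pair of
contracted indices `αᵢ`, `αᵢ`, and `E_{αᵢ₋₁αᵢ}` has passed through `aⱼ` for all `j > i`. -/
def traceWord (V : EvenScalarSpace K ι) (k k' : ℕ) (w : List ι) : (V.tensorGL k k').F :=
  ∑ α : Fin w.length → Fin k ⊕ Fin k',
    sgn K ((∑ i : Fin w.length, if (i : ℕ) + 1 < w.length then glPar (α i) else 0) +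
        ∑ i : Fin w.length, ∑ j : Fin w.length,
          if i < j then
            (glPar (α ((finRotate w.length).symm i)) + glPar (α i)) * V.letter (w.get j)
          else 0) •
      (V.tensorGL k k').cword
        (List.ofFn fun i => (w.get i, α ((finRotate w.length).symm i), α i))

/-! ### The `gl(k|k')`-symmetry -/

/-- The parities of the letters `π e_i ⊗ E_{αβ}` and of one more letter `t` (the letter `none`),
which has the parity of `E_{γδ}`. -/
def extLetter (V : EvenScalarSpace K ι) (k k' : ℕ) (γ δ : Fin k ⊕ Fin k') :
    Option (ι × (Fin k ⊕ Fin k') × (Fin k ⊕ Fin k')) → ZMod 2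
  | none => glPar γ + glPar δ
  | some x => (V.tensorGL k k').letter x

/-- The words that arise from `pre · x · post` when the letter `x = a ⊗ E_{αβ}` is replaced by the
commutator `[t ⊗ E_{γδ}, a ⊗ E_{αβ}] = ± t (a ⊗ E_{γδ} E_{αβ}) - ± (a ⊗ E_{αβ} E_{γδ}) t`. -/
def glVarAt (V : EvenScalarSpace K ι) {k k' : ℕ} (γ δ : Fin k ⊕ Fin k')
    (pre : List (Option (ι × (Fin k ⊕ Fin k') × (Fin k ⊕ Fin k'))))
    (x : ι × (Fin k ⊕ Fin k') × (Fin k ⊕ Fin k'))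
    (post : List (Option (ι × (Fin k ⊕ Fin k') × (Fin k ⊕ Fin k')))) :
    CycAlg K (V.extLetter k k' γ δ) :=
  (if δ = x.2.1 then
    sgn K ((glPar γ + glPar δ) * V.letter x.1) •
      word K (V.extLetter k k' γ δ) (pre ++ ([none, some (x.1, γ, x.2.2)] ++ post))
    else 0) -
  (if x.2.2 = γ then
    sgn K (glPar γ + glPar δ) •
      word K (V.extLetter k k' γ δ) (pre ++ ([some (x.1, x.2.1, δ), none] ++ post))
    else 0)

/-- The sum of `glVarAt` over all letters of the second list, `pre` being the letters that precede
it. -/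
def glVarAux (V : EvenScalarSpace K ι) {k k' : ℕ} (γ δ : Fin k ⊕ Fin k') :
    List (Option (ι × (Fin k ⊕ Fin k') × (Fin k ⊕ Fin k'))) →
    List (ι × (Fin k ⊕ Fin k') × (Fin k ⊕ Fin k')) → CycAlg K (V.extLetter k k' γ δ)
  | _, [] => 0
  | pre, x :: post =>
      V.glVarAt γ δ pre x (post.map some) + V.glVarAux γ δ (pre ++ [some x]) post

/-- The value on a word `(x₁ … xᵣ)ᶜ` of the infinitesimal action of `t ⊗ E_{γδ}`: the sum over `i`
of the words with `xᵢ` replaced by the commutator `[t ⊗ E_{γδ}, xᵢ]`. -/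
def glVarWord (V : EvenScalarSpace K ι) {k k' : ℕ} (γ δ : Fin k ⊕ Fin k')
    (w : List (ι × (Fin k ⊕ Fin k') × (Fin k ⊕ Fin k'))) : CycAlg K (V.extLetter k k' γ δ) :=
  V.glVarAux γ δ [] w

theorem wp_map_some (V : EvenScalarSpace K ι) {k k' : ℕ} (γ δ : Fin k ⊕ Fin k')
    (w : List (ι × (Fin k ⊕ Fin k') × (Fin k ⊕ Fin k'))) :
    wp (V.extLetter k k' γ δ) (w.map some) = wp (V.tensorGL k k').letter w := by
  induction w with
  | nil => rfl
  | cons x w ih => rw [List.map_cons, wp_cons, wp_cons, ih]; rfl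

theorem wp_insert_left (V : EvenScalarSpace K ι) {k k' : ℕ} (γ δ : Fin k ⊕ Fin k')
    {x : ι × (Fin k ⊕ Fin k') × (Fin k ⊕ Fin k')} (h : δ = x.2.1) :
    wp (V.extLetter k k' γ δ) [none, some (x.1, γ, x.2.2)] = (V.tensorGL k k').letter x := by
  simp only [wp_cons, wp_nil, extLetter, letter, tensorGL, h]
  generalize glPar x.2.1 = p
  generalize glPar x.2.2 = q
  generalize glPar γ = r
  generalize V.parity x.1 = s
  revert p q r s
  decide

theorem wp_insert_right (V : EvenScalarSpace K ι) {k k' : ℕ} (γ δ : Fin k ⊕ Fin k')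
    {x : ι × (Fin k ⊕ Fin k') × (Fin k ⊕ Fin k')} (h : x.2.2 = γ) :
    wp (V.extLetter k k' γ δ) [some (x.1, x.2.1, δ), none] = (V.tensorGL k k').letter x := by
  simp only [wp_cons, wp_nil, extLetter, letter, tensorGL, h]
  generalize glPar x.2.1 = p
  generalize glPar δ = q
  generalize glPar γ = r
  generalize V.parity x.1 = s
  revert p q r s
  decide

theorem glVarAt_append (V : EvenScalarSpace K ι) {k k' : ℕ} (γ δ : Fin k ⊕ Fin k')
    (u pre : List (Option (ι × (Fin k ⊕ Fin k') × (Fin k ⊕ Fin k'))))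
    (x : ι × (Fin k ⊕ Fin k') × (Fin k ⊕ Fin k'))
    (post : List (Option (ι × (Fin k ⊕ Fin k') × (Fin k ⊕ Fin k')))) :
    V.glVarAt γ δ (u ++ pre) x post =
      sgn K (wp (V.extLetter k k' γ δ) u * (wp (V.extLetter k k' γ δ) pre +
        ((V.tensorGL k k').letter x + wp (V.extLetter k k' γ δ) post))) •
      V.glVarAt γ δ pre x (post ++ u) := by
  unfold glVarAt
  rw [smul_sub]
  congr 1
  · split_ifs with h
    · rw [List.append_assoc, word_append u, wp_append, wp_append, wp_insert_left V γ δ h,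
        smul_comm]
      simp only [List.append_assoc]
    · rw [smul_zero]
  · split_ifs with h
    · rw [List.append_assoc, word_append u, wp_append, wp_append, wp_insert_right V γ δ h,
        smul_comm]
      simp only [List.append_assoc]
    · rw [smul_zero]

theorem glVarAux_append (V : EvenScalarSpace K ι) {k k' : ℕ} (γ δ : Fin k ⊕ Fin k')
    (a : ι × (Fin k ⊕ Fin k') × (Fin k ⊕ Fin k'))
    (u : List (ι × (Fin k ⊕ Fin k') × (Fin k ⊕ Fin k'))) :
    ∀ pre : List (Option (ι × (Fin k ⊕ Fin k') × (Fin k ⊕ Fin k'))),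
      sgn K ((V.tensorGL k k').letter a *
          (wp (V.extLetter k k' γ δ) pre + wp (V.tensorGL k k').letter u)) •
        V.glVarAux γ δ pre (u ++ [a]) =
      V.glVarAux γ δ (some a :: pre) u +
      sgn K ((V.tensorGL k k').letter a *
          (wp (V.extLetter k k' γ δ) pre + wp (V.tensorGL k k').letter u)) •
        V.glVarAt γ δ (pre ++ u.map some) a [] := by
  induction u with
  | nil => intro pre; simp [glVarAux]
  | cons x u ih =>
    intro pre
    have h1 := V.glVarAt_append γ δ [some a] pre x (u.map some)
    have h2 := ih (pre ++ [some x])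
    simp only [wp_cons, wp_append, wp_nil, add_zero, wp_map_some, List.append_assoc,
      List.cons_append, List.nil_append, extLetter] at h1 h2
    simp only [List.cons_append, glVarAux, List.map_append, List.map_cons, List.map_nil,
      smul_add, wp_cons]
    rw [← add_assoc (wp (V.extLetter k k' γ δ) pre)]
    rw [h2, h1, ← add_assoc (wp (V.extLetter k k' γ δ) pre)]
    simp only [add_assoc]

theorem glVarWord_rot (V : EvenScalarSpace K ι) {k k' : ℕ} (γ δ : Fin k ⊕ Fin k')
    (a : ι × (Fin k ⊕ Fin k') × (Fin k ⊕ Fin k'))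
    (u : List (ι × (Fin k ⊕ Fin k') × (Fin k ⊕ Fin k'))) :
    V.glVarWord γ δ (a :: u) =
      sgn K ((V.tensorGL k k').letter a * wp (V.tensorGL k k').letter u) •
        V.glVarWord γ δ (u ++ [a]) := by
  have h := V.glVarAux_append γ δ a u []
  have h1 := V.glVarAt_append γ δ (u.map some) [] a []
  simp only [wp_nil, zero_add, List.nil_append, add_zero, wp_map_some, List.append_nil] at h h1
  rw [glVarWord, glVarWord, h, h1, smul_smul, mul_comm (wp (V.tensorGL k k').letter u),
    sgn_mul_self, one_smul, glVarAux, add_comm]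
  rfl

theorem glVarAux_hasPar (V : EvenScalarSpace K ι) {k k' : ℕ} (γ δ : Fin k ⊕ Fin k')
    (w : List (ι × (Fin k ⊕ Fin k') × (Fin k ⊕ Fin k'))) :
    ∀ pre : List (Option (ι × (Fin k ⊕ Fin k') × (Fin k ⊕ Fin k'))),
      HasPar (wp (V.extLetter k k' γ δ) pre + wp (V.tensorGL k k').letter w + 1)
        (V.glVarAux γ δ pre w) := by
  induction w with
  | nil => intro pre; exact HasPar.zero _
  | cons x w ih =>
    intro pre
    rw [glVarAux]
    refine HasPar.add ?_ ?_
    · rw [glVarAt, sub_eq_add_neg, ← neg_one_smul K]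
      refine HasPar.add ?_ (HasPar.smul _ ?_)
      · split_ifs with h
        · have h1 := (HasPar.word (K := K) (lp := V.extLetter k k' γ δ)
            (pre ++ ([none, some (x.1, γ, x.2.2)] ++ w.map some)))
          rw [wp_append, wp_append, wp_insert_left V γ δ h, wp_map_some, ← wp_cons] at h1
          exact h1.smul _
        · exact HasPar.zero _
      · split_ifs with h
        · have h1 := (HasPar.word (K := K) (lp := V.extLetter k k' γ δ)
            (pre ++ ([some (x.1, x.2.1, δ), none] ++ w.map some)))
          rw [wp_append, wp_append, wp_insert_right V γ δ h, wp_map_some, ← wp_cons] at h1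
          exact h1.smul _
        · exact HasPar.zero _
    · have h1 := ih (pre ++ [some x])
      rw [wp_append, wp_cons, wp_nil, add_zero, add_assoc (wp _ pre)] at h1
      rw [wp_cons]
      exact h1

/-- The algebra map `F(V ⊗ gl(k|k')) → CycAlg` that adds the letter `t` to the alphabet. -/
def inclT (V : EvenScalarSpace K ι) {k k' : ℕ} (γ δ : Fin k ⊕ Fin k') :
    (V.tensorGL k k').F →ₐ[K] CycAlg K (V.extLetter k k' γ δ) :=
  RingQuot.liftAlgHom K
    ⟨FreeAlgebra.lift K fun w => word K (V.extLetter k k' γ δ) (w.map some), by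
      intro x y h
      induction h with
      | empty => simp [word_nil]
      | rot a u =>
        simp only [FreeAlgebra.lift_ι_apply, map_smul, List.map_cons, List.map_append,
          List.map_nil]
        rw [word_rot, wp_map_some]
        rfl
      | comm u v =>
        simp only [FreeAlgebra.lift_ι_apply, map_mul, map_smul]
        rw [word_comm, wp_map_some, wp_map_some]⟩

theorem inclT_word (V : EvenScalarSpace K ι) {k k' : ℕ} (γ δ : Fin k ⊕ Fin k')
    (w : List (ι × (Fin k ⊕ Fin k') × (Fin k ⊕ Fin k'))) :
    V.inclT γ δ ((V.tensorGL k k').cword w) = word K (V.extLetter k k' γ δ) (w.map some) := by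
  simp [inclT, cword, word]

/-- The infinitesimal action of `t ⊗ E_{γδ}` on `F(V ⊗ gl(k|k'))`, where `t` is a new letter of the
parity of `E_{γδ}` (a generic noncommutative parameter): the even derivation along `inclT` that
replaces every letter `x`, one at a time, by `[t ⊗ E_{γδ}, x]`. -/
def glVar (V : EvenScalarSpace K ι) {k k' : ℕ} (γ δ : Fin k ⊕ Fin k') :
    (V.tensorGL k k').F →ₗ[K] CycAlg K (V.extLetter k k' γ δ) :=
  recOp (fun w => word K (V.extLetter k k' γ δ) (w.map some)) (fun w => V.glVarWord γ δ w)
    (fun _ => 1) (fun _ => 0) <| by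
    refine recOp_rel _ _ _ _ word_nil rfl (fun _ => rfl) (fun a u => ?_) (V.glVarWord_rot γ δ)
      (fun _ _ _ => by simp) (fun _ _ => rfl) (fun u v => ?_) (fun u v y => ?_)
    · rw [List.map_cons, word_rot, wp_map_some, List.map_append]
      rfl
    · rw [word_comm, wp_map_some, wp_map_some]
    · have h : ∀ u v : List (ι × (Fin k ⊕ Fin k') × (Fin k ⊕ Fin k')),
          V.glVarWord γ δ u * (word K (V.extLetter k k' γ δ) (v.map some) * y) =
          sgn K ((wp (V.tensorGL k k').letter u + 1) * (wp (V.tensorGL k k').letter v + 1)) •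
            (word K (V.extLetter k k' γ δ) (v.map some) * (V.glVarWord γ δ u * y)) := by
        intro u v
        have h1 := V.glVarAux_hasPar γ δ u [] (v.map some)
        rw [wp_nil, zero_add, wp_map_some] at h1
        rw [← mul_assoc, glVarWord, h1, smul_mul_assoc, mul_assoc]
      simp only [LinearMap.zero_apply, add_zero, one_smul]
      rw [h u v, h v u, smul_add, smul_smul, mul_comm (wp (V.tensorGL k k').letter v + 1),
        sgn_mul_self, one_smul, add_comm]

theorem glVar_word_mul (V : EvenScalarSpace K ι) {k k' : ℕ} (γ δ : Fin k ⊕ Fin k')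
    (w : List (ι × (Fin k ⊕ Fin k') × (Fin k ⊕ Fin k'))) (y : (V.tensorGL k k').F) :
    V.glVar γ δ ((V.tensorGL k k').cword w * y) =
      V.glVarWord γ δ w * V.inclT γ δ y +
        V.inclT γ δ ((V.tensorGL k k').cword w) * V.glVar γ δ y := by
  refine (recOp_mul _ _ _ _ _ (V.inclT γ δ) (V.inclT_word γ δ) w y).trans ?_
  rw [LinearMap.zero_apply, add_zero, one_smul, inclT_word]
  rfl

/-- `S ∈ F(V ⊗ gl(k|k'))[[ħ]]` is `gl(k|k')`-symmetric: it is annihilated by the infinitesimal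
action of `t ⊗ X` for all `X ∈ gl(k|k')`, `t` being a generic noncommutative parameter. -/
def IsGlSymmetric (V : EvenScalarSpace K ι) {k k' : ℕ} (S : (V.tensorGL k k').F⟦X⟧) : Prop :=
  ∀ (γ δ : Fin k ⊕ Fin k') (n : ℕ), V.glVar γ δ (PowerSeries.coeff n S) = 0

end EvenScalarSpace
end NCBV

/-!
Write `n` for the index set of `gl(k|k')` and think of the letter `a ⊗ E_{βε}` as the product
`e_β a e_ε*`. A cyclic word in such letters has a *junction* `e_ε* e_β` between any two neighbours.
A junction is either a fixed pair `(ε, β)` or *closed*, which means that it is contracted to the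
invariant `∑ ε, ± e_ε* e_ε`. The super trace of a word of `F(V)` is the word all of whose junctions
are closed. `loop f l` is the sum of `f` over all words whose letters and junctions are prescribed
by `l`, with the Koszul signs factored letter by letter; `traceWord_eq_loop` identifies it with the
trace. The fact that carries the signs is `loop_append_rot`: the sum over a rotated list is the
sum of the rotated words. By `loop_rotSum` the trace therefore commutes with cyclic
symmetrisation, and every identity about cyclic words has to be checked at one letter only.

*The trace is a map of Batalin–Vilkovisky algebras.* The form on `V ⊗ gl(k|k')` contracts indices
by matching both index pairs of its arguments, so that dissecting or gluing traces at prescribed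
letters gives products of traces or a trace (`loop_cutHead`, `loop_glueHead`). Hence
`traceHom_bv`, and solutions go to solutions.

*The trace is injective if `n` is nonempty.* Keeping only the letters `a ⊗ E_{αα}` for one fixed
`α` is a retraction (`diagHom_traceHom`). Hence `S` solves the equation if its trace does.

*Traces are invariant.* The commutator inserts `t` to the left of a letter and, with the opposite
sign, to the right of the preceding one. Where junctions are closed both insertions agree, and the
sum telescopes around the word (`loop_glVarWord`).

*Invariants are traces.* As `t` is a letter of its own, it marks the junction at which it was
inserted. Fix `α`. Undoing the insertion of `t ⊗ E_{αδ}` by contracting the neighbouring index with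
`α` is a derivation `contractT α δ` along `t ↦ 0`, and the sum over `δ` of all `contractT α δ` after
`glVar α δ` is an even derivation `openCount α` of `F(V ⊗ gl(k|k'))`. It replaces each junction
`J`, one at a time, by `J` minus its coefficient at `(α, α)` times the closed junction. So a word
whose junctions are closed or different from `(α, α)` is an eigenvector, and the eigenvalue is the
number of its junctions that are not closed (`openCount_loop`). Such words span all words, because
the junction `(α, α)` is the closed one minus the other `(δ, δ)`. Since `openCount α` is a
derivation, its eigenspaces multiply, and the whole algebra is the sum of the traces and of
eigenspaces with positive integral eigenvalue (`mem_eigenSum`). In characteristic zero the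
latter meet the kernel in zero, so the kernel of `openCount α` consists of traces.
-/

open scoped PowerSeries

namespace NCBV

namespace EvenScalarSpace

/-! ### Sums over the matrix indices of a cyclic word -/

section chains

variable {K : Type*} [Field K] {ι : Type*} {k k' : ℕ}

/-- The letters of `V ⊗ gl(k|k')`: `(a, β, ε)` stands for `a ⊗ E_{βε}`. -/
abbrev GlLetter (ι : Type*) (k k' : ℕ) : Type _ := ι × (Fin k ⊕ Fin k') × (Fin k ⊕ Fin k')

/-- The junction between two neighbouring letters of a cyclic word: `some (ε, β)` prescribes the
right index `ε` of the first and the left index `β` of the second letter, `none` is the closed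
junction, where the two indices agree and are summed over. -/
abbrev Junction (k k' : ℕ) : Type := Option ((Fin k ⊕ Fin k') × (Fin k ⊕ Fin k'))

/-- The parity of a junction. -/
def junctionPar : Junction k k' → ZMod 2
  | none => 0
  | some p => glPar p.1 + glPar p.2

/-- The sum of `F ε β` over the pairs of indices `(ε, β)` that a junction allows. -/
def junctionSum {A : Type*} [AddCommMonoid A] :
    Junction k k' → ((Fin k ⊕ Fin k') → (Fin k ⊕ Fin k') → A) → A
  | none, F => ∑ ε, F ε ε
  | some p, F => F p.1 p.2

theorem junctionSum_congr {A : Type*} [AddCommMonoid A] {j : Junction k k'}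
    {F G : (Fin k ⊕ Fin k') → (Fin k ⊕ Fin k') → A}
    (h : ∀ ε β, glPar ε + glPar β = junctionPar j → F ε β = G ε β) :
    junctionSum j F = junctionSum j G := by
  cases j with
  | none => exact Finset.sum_congr rfl fun ε _ => h _ _ (CharTwo.add_self_eq_zero _)
  | some p => exact h _ _ rfl

theorem junctionSum_add {A : Type*} [AddCommMonoid A] (j : Junction k k')
    (F G : (Fin k ⊕ Fin k') → (Fin k ⊕ Fin k') → A) :
    junctionSum j (fun ε β => F ε β + G ε β) = junctionSum j F + junctionSum j G := by
  cases j with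
  | none => exact Finset.sum_add_distrib
  | some p => rfl

theorem junctionSum_smul {A : Type*} [AddCommMonoid A] [Module K A] (j : Junction k k') (c : K)
    (F : (Fin k ⊕ Fin k') → (Fin k ⊕ Fin k') → A) :
    junctionSum j (fun ε β => c • F ε β) = c • junctionSum j F := by
  cases j with
  | none => exact Finset.smul_sum.symm
  | some p => rfl

theorem sum_junctionSum {A J : Type*} [AddCommMonoid A] (s : Finset J) (j : Junction k k')
    (F : J → (Fin k ⊕ Fin k') → (Fin k ⊕ Fin k') → A) :
    ∑ i ∈ s, junctionSum j (F i) = junctionSum j fun ε β => ∑ i ∈ s, F i ε β := by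
  cases j with
  | none => exact Finset.sum_comm
  | some p => rfl

theorem map_junctionSum {A B : Type*} [AddCommMonoid A] [Module K A] [AddCommMonoid B] [Module K B]
    (T : A →ₗ[K] B) (j : Junction k k') (F : (Fin k ⊕ Fin k') → (Fin k ⊕ Fin k') → A) :
    T (junctionSum j F) = junctionSum j (fun ε β => T (F ε β)) := by
  cases j with
  | none => exact map_sum T _ _
  | some p => rfl

/-- The parity of a letter of `V` together with the junction that follows it. -/
def mixedLetter (V : EvenScalarSpace K ι) (k k' : ℕ) (x : ι × Junction k k') : ZMod 2 :=
  V.letter x.1 + junctionPar x.2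

/-- The sum of `f x e` over all words `x` whose left index is `β` and whose letters and junctions
are prescribed by the list; `e` is the index that the last junction hands on. Each letter
`a ⊗ E_{βε} = ± e_β a e_ε*` comes with the sign `(-1)^{(|a| + 1) |β|}`: `(-1)^{|a| |β|}` for moving
`e_β` past `a`, and `(-1)^{|β|}` for the super trace over the pair of contracted indices. -/
def chain (V : EvenScalarSpace K ι) {A : Type*} [AddCommGroup A] [Module K A] :
    (List (GlLetter ι k k') → (Fin k ⊕ Fin k') → A) → (Fin k ⊕ Fin k') →
      List (ι × Junction k k') → A
  | f, β, [] => f [] β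
  | f, β, x :: l => sgn K ((V.letter x.1 + 1) * glPar β) •
      junctionSum x.2 fun ε β' => chain V (fun y e => f ((x.1, β, ε) :: y) e) β' l

variable (V : EvenScalarSpace K ι) {A B : Type*} [AddCommGroup A] [Module K A] [AddCommGroup B]
  [Module K B]

theorem tensorGL_letter (x : GlLetter ι k k') :
    (V.tensorGL k k').letter x = V.letter x.1 + (glPar x.2.1 + glPar x.2.2) := by
  simp only [letter, tensorGL]
  ring

theorem chain_cons (f : List (GlLetter ι k k') → (Fin k ⊕ Fin k') → A) (β : Fin k ⊕ Fin k')
    (x : ι × Junction k k') (l : List (ι × Junction k k')) :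
    V.chain f β (x :: l) = sgn K ((V.letter x.1 + 1) * glPar β) •
      junctionSum x.2 fun ε β' => V.chain (fun y e => f ((x.1, β, ε) :: y) e) β' l := rfl

theorem chain_congr (l : List (ι × Junction k k')) :
    ∀ {f g : List (GlLetter ι k k') → (Fin k ⊕ Fin k') → A} {β : Fin k ⊕ Fin k'},
    (∀ x e, x.length = l.length →
      wp (V.tensorGL k k').letter x = wp (V.mixedLetter k k') l + glPar β + glPar e →
      f x e = g x e) → V.chain f β l = V.chain g β l := by
  induction l with
  | nil => exact fun h => h _ _ rfl (by simp [CharTwo.add_self_eq_zero])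
  | cons x l ih =>
    intro f g β h
    rw [chain_cons, chain_cons]
    congr 1
    refine junctionSum_congr fun ε β' hj => ih fun y e hy hp => h _ _ (by simp [hy]) ?_
    rw [wp_cons, hp, wp_cons, tensorGL_letter, mixedLetter, ← hj]
    generalize wp _ l = p
    generalize V.letter x.1 = q
    generalize glPar β = r
    generalize glPar β' = s
    generalize glPar ε = t
    generalize glPar e = u
    revert p q r s t u
    decide

theorem chain_append (l' : List (ι × Junction k k')) (l : List (ι × Junction k k')) :
    ∀ (f : List (GlLetter ι k k') → (Fin k ⊕ Fin k') → A) (β : Fin k ⊕ Fin k'),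
      V.chain f β (l ++ l') = V.chain (fun x e => V.chain (fun y => f (x ++ y)) e l') β l := by
  induction l with
  | nil => intro f β; rfl
  | cons x l ih => intro f β; simp only [List.cons_append, chain_cons, ih]

theorem map_chain (T : A →ₗ[K] B) (l : List (ι × Junction k k')) :
    ∀ (f : List (GlLetter ι k k') → (Fin k ⊕ Fin k') → A) (β : Fin k ⊕ Fin k'),
      T (V.chain f β l) = V.chain (fun x e => T (f x e)) β l := by
  induction l with
  | nil => intro f β; rfl
  | cons x l ih => intro f β; simp only [chain_cons, map_smul, map_junctionSum, ih]

theorem chain_add (l : List (ι × Junction k k')) :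
    ∀ (f g : List (GlLetter ι k k') → (Fin k ⊕ Fin k') → A) (β : Fin k ⊕ Fin k'),
      V.chain (fun x e => f x e + g x e) β l = V.chain f β l + V.chain g β l := by
  induction l with
  | nil => intro f g β; rfl
  | cons x l ih => intro f g β; simp only [chain_cons, ih, junctionSum_add, smul_add]

theorem chain_smul (c : K) (f : List (GlLetter ι k k') → (Fin k ⊕ Fin k') → A)
    (β : Fin k ⊕ Fin k') (l : List (ι × Junction k k')) :
    V.chain (fun x e => c • f x e) β l = c • V.chain f β l :=
  (V.map_chain (c • LinearMap.id) l f β).symm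

/-- `chain` as a linear map of the function that is summed. -/
def chainHom (A : Type*) [AddCommGroup A] [Module K A] (β : Fin k ⊕ Fin k')
    (l : List (ι × Junction k k')) :
    (List (GlLetter ι k k') → (Fin k ⊕ Fin k') → A) →ₗ[K] A where
  toFun f := V.chain f β l
  map_add' f g := V.chain_add l f g β
  map_smul' c f := V.chain_smul c f β l

theorem chain_zero (β : Fin k ⊕ Fin k') (l : List (ι × Junction k k')) :
    V.chain (fun _ _ => (0 : A)) β l = 0 := map_zero (V.chainHom A β l)

theorem chain_sum {J : Type*} (s : Finset J)
    (f : J → List (GlLetter ι k k') → (Fin k ⊕ Fin k') → A) (β : Fin k ⊕ Fin k')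
    (l : List (ι × Junction k k')) :
    V.chain (fun x e => ∑ i ∈ s, f i x e) β l = ∑ i ∈ s, V.chain (f i) β l := by
  have h := map_sum (V.chainHom A β l) f s
  have e : (∑ i ∈ s, f i) = fun x e => ∑ i ∈ s, f i x e := by
    funext x e; simp only [Finset.sum_apply]
  rw [e] at h
  exact h

theorem chain_ite (P : Prop) [Decidable P] (f : List (GlLetter ι k k') → (Fin k ⊕ Fin k') → A)
    (β : Fin k ⊕ Fin k') (l : List (ι × Junction k k')) :
    V.chain (fun x e => if P then f x e else 0) β l = if P then V.chain f β l else 0 := by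
  split_ifs
  · rfl
  · exact V.chain_zero β l

theorem chain_comm
    (f : List (GlLetter ι k k') → (Fin k ⊕ Fin k') → List (GlLetter ι k k') →
      (Fin k ⊕ Fin k') → A) (β β' : Fin k ⊕ Fin k') (l l' : List (ι × Junction k k')) :
    V.chain (fun x e => V.chain (f x e) β' l') β l =
      V.chain (fun y e' => V.chain (fun x e => f x e y e') β l) β' l' := by
  refine (V.map_chain (V.chainHom A β' l') l f β).symm.trans ?_
  refine congrArg (fun g => V.chain g β' l') (funext fun y => funext fun e' => ?_)
  exact V.map_chain ((LinearMap.proj (φ := fun _ : Fin k ⊕ Fin k' => A) e') ∘ₗ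
    (LinearMap.proj (φ := fun _ : List (GlLetter ι k k') => (Fin k ⊕ Fin k') → A) y)) l f β

/-- The super trace: the sum of `f x` over all cyclic words `x` whose letters and junctions are
prescribed by `l`. The overall sign comes from moving the left index `e_β` of the first letter
past the rest of the word. -/
def loop (f : List (GlLetter ι k k') → A) (l : List (ι × Junction k k')) : A :=
  ∑ β, sgn K (glPar β * (wp (V.mixedLetter k k') l + 1)) •
    V.chain (fun x e => if e = β then f x else 0) β l

theorem map_loop (T : A →ₗ[K] B) (f : List (GlLetter ι k k') → A)
    (l : List (ι × Junction k k')) :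
    T (V.loop f l) = V.loop (fun x => T (f x)) l := by
  simp only [loop, map_sum, map_smul, map_chain, apply_ite T, map_zero]

theorem loop_congr {f g : List (GlLetter ι k k') → A} {l : List (ι × Junction k k')}
    (h : ∀ x, x.length = l.length →
      wp (V.tensorGL k k').letter x = wp (V.mixedLetter k k') l → f x = g x) :
    V.loop f l = V.loop g l := by
  refine Finset.sum_congr rfl fun β _ => ?_
  congr 1
  refine V.chain_congr l fun x e hx hp => ?_
  split_ifs with he
  · subst he
    exact h x hx (by rw [hp, add_assoc, CharTwo.add_self_eq_zero, add_zero])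
  · rfl

theorem loop_smul (c : K) (f : List (GlLetter ι k k') → A) (l : List (ι × Junction k k')) :
    V.loop (fun x => c • f x) l = c • V.loop f l := by
  have h := V.map_loop (c • (LinearMap.id : A →ₗ[K] A)) f l
  simp only [LinearMap.smul_apply, LinearMap.id_coe, id_eq] at h
  exact h.symm

theorem loop_sub (f g : List (GlLetter ι k k') → A) (l : List (ι × Junction k k')) :
    V.loop (fun x => f x - g x) l = V.loop f l - V.loop g l := by
  rw [loop, loop, loop, ← Finset.sum_sub_distrib]
  refine Finset.sum_congr rfl fun β _ => ?_
  have h := map_sub (V.chainHom A β l) (fun x e => if e = β then f x else 0)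
    (fun x e => if e = β then g x else 0)
  refine Eq.trans ?_ ((congrArg (_ • ·) h).trans (smul_sub _ _ _))
  refine congrArg (fun F => sgn K _ • V.chain F β l) (funext fun x => funext fun e => ?_)
  by_cases he : e = β <;> simp [he]

theorem loop_add (f g : List (GlLetter ι k k') → A) (l : List (ι × Junction k k')) :
    V.loop (fun x => f x + g x) l = V.loop f l + V.loop g l := by
  have h := V.loop_sub (fun x => f x + g x) g l
  simp only [add_sub_cancel_right] at h
  rw [h, sub_add_cancel]

theorem loop_sum {J : Type*} (s : Finset J) (f : J → List (GlLetter ι k k') → A)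
    (l : List (ι × Junction k k')) :
    V.loop (fun x => ∑ i ∈ s, f i x) l = ∑ i ∈ s, V.loop (f i) l := by
  simp only [loop]
  rw [Finset.sum_comm]
  refine Finset.sum_congr rfl fun β _ => ?_
  rw [← Finset.smul_sum, ← chain_sum]
  congr 2
  funext x e
  split_ifs <;> simp

/-- Cyclic invariance of the super trace: summing over rotated words is summing along the rotated
list. All Koszul signs of rotations are dealt with here. -/
theorem loop_append_rot (f : List (GlLetter ι k k') → A) (u v : List (ι × Junction k k')) :
    V.loop (fun z => sgn K (wp (V.tensorGL k k').letter (z.take u.length) *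
        wp (V.tensorGL k k').letter (z.drop u.length)) •
          f (z.drop u.length ++ z.take u.length)) (u ++ v) =
      sgn K (wp (V.mixedLetter k k') u * wp (V.mixedLetter k k') v) • V.loop f (v ++ u) := by
  have h1 : ∀ β : Fin k ⊕ Fin k', sgn K (glPar β * (wp (V.mixedLetter k k') (u ++ v) + 1)) •
      V.chain (fun z e => if e = β then sgn K (wp (V.tensorGL k k').letter (z.take u.length) *
        wp (V.tensorGL k k').letter (z.drop u.length)) •
          f (z.drop u.length ++ z.take u.length) else 0) β (u ++ v) =
      ∑ γ, sgn K (wp (V.mixedLetter k k') u * wp (V.mixedLetter k k') v +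
        glPar γ * (wp (V.mixedLetter k k') (v ++ u) + 1)) • V.chain (fun x e =>
        V.chain (fun y e' => if e = γ then if e' = β then f (y ++ x) else 0 else 0) γ v) β u := by
    -- Cut the path where `u` ends; `γ` is the index of that junction.
    intro β
    rw [chain_append, ← chain_smul]
    simp only [← chain_smul]
    rw [← chain_sum]
    refine V.chain_congr u fun x e hx hp => ?_
    rw [Finset.sum_eq_single e (fun γ _ hγ => ?_) (by simp)]
    · refine V.chain_congr v fun y e' hy hq => ?_
      rw [if_pos rfl]
      split_ifs with he
      · subst he
        rw [← hx, List.take_left, List.drop_left, smul_smul, ← sgn_add, hp, hq]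
        congr 2
        simp only [wp_append]
        generalize wp _ u = p
        generalize wp _ v = q
        generalize glPar e = r
        generalize glPar e' = s
        revert p q r s
        decide
      · rw [smul_zero, smul_zero]
    · simp only [if_neg (Ne.symm hγ), smul_zero]
      exact V.chain_zero γ v
  rw [loop, Finset.sum_congr rfl fun β _ => h1 β, Finset.sum_comm, loop, Finset.smul_sum]
  refine Finset.sum_congr rfl fun γ _ => ?_
  rw [← Finset.smul_sum, smul_smul, ← sgn_add]
  congr 1
  -- The path along `v ++ u` from `γ` runs through the same two halves in the other order.
  rw [chain_append, Finset.sum_congr rfl fun β _ => V.chain_comm _ β γ u v, ← chain_sum]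
  congr 1
  funext y e'
  rw [Finset.sum_eq_single e' (fun β _ hβ => ?_) (by simp)]
  · simp
  · simp only [if_neg (Ne.symm hβ), ite_self]
    exact V.chain_zero β u

/-- The super trace commutes with cyclic symmetrisation. -/
theorem loop_rotSum (f : List (GlLetter ι k k') → A) (l : List (ι × Junction k k')) :
    V.loop (fun x => rotSum (K := K) (V.tensorGL k k').letter f x) l =
      rotSum (K := K) (V.mixedLetter k k') (V.loop f) l := by
  have h : V.loop (fun x => rotSum (K := K) (V.tensorGL k k').letter f x) l =
      ∑ i ∈ Finset.range l.length, V.loop (fun x =>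
        sgn K (wp (V.tensorGL k k').letter (x.take i) * wp (V.tensorGL k k').letter (x.drop i)) •
          f (x.drop i ++ x.take i)) l := by
    rw [← loop_sum]
    refine V.loop_congr fun x hx _ => ?_
    rw [rotSum, hx]
  rw [h, rotSum]
  refine Finset.sum_congr rfl fun i hi => ?_
  have hi' : (l.take i).length = i := by simp [(Finset.mem_range.1 hi).le]
  have h2 := V.loop_append_rot f (l.take i) (l.drop i)
  rwa [List.take_append_drop, hi'] at h2

/-- The super trace inherits the rotation covariance of cyclic words. -/
theorem loop_append {f : List (GlLetter ι k k') → A}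
    (hf : ∀ x y, f (x ++ y) = sgn K (wp (V.tensorGL k k').letter x *
      wp (V.tensorGL k k').letter y) • f (y ++ x)) (u v : List (ι × Junction k k')) :
    V.loop f (u ++ v) =
      sgn K (wp (V.mixedLetter k k') u * wp (V.mixedLetter k k') v) • V.loop f (v ++ u) := by
  rw [← loop_append_rot]
  refine V.loop_congr fun z _ _ => ?_
  rw [← hf, List.take_append_drop]

end chains

/-! ### The trace of a word as a sum over closed junctions -/

section traces

variable {K : Type*} [Field K] {ι : Type*} {k k' : ℕ} (V : EvenScalarSpace K ι)
  {A : Type*} [AddCommGroup A] [Module K A]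

/-- The list of letters of `w` with all junctions closed. -/
def closed (k k' : ℕ) (w : List ι) : List (ι × Junction k k') := w.map fun a => (a, none)

theorem wp_closed (w : List ι) : wp (V.mixedLetter k k') (closed k k' w) = wp V.letter w := by
  induction w with
  | nil => rfl
  | cons a w ih =>
    rw [closed, List.map_cons, wp_cons, wp_cons, ← ih]
    simp [mixedLetter, junctionPar, closed]

theorem chain_closed_eq_sum (w : List ι) :
    ∀ (f : List (GlLetter ι k k') → (Fin k ⊕ Fin k') → A) (β : Fin k ⊕ Fin k'),
      V.chain f β (closed k k' w) = ∑ α : Fin w.length → Fin k ⊕ Fin k',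
        sgn K (∑ i, (V.letter (w.get i) + 1) *
          glPar ((Fin.cons β α : Fin (w.length + 1) → Fin k ⊕ Fin k') i.castSucc)) •
        f (List.ofFn fun i => (w.get i,
          (Fin.cons β α : Fin (w.length + 1) → Fin k ⊕ Fin k') i.castSucc, α i))
          ((Fin.cons β α : Fin (w.length + 1) → Fin k ⊕ Fin k') (Fin.last _)) := by
  induction w with
  | nil =>
    intro f β
    simp [closed, chain, sgn_zero]
  | cons a w ih =>
    intro f β
    change sgn K _ • ∑ ε, V.chain (fun x e => f ((a, β, ε) :: x) e) ε (closed k k' w) =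
      ∑ α : Fin (w.length + 1) → Fin k ⊕ Fin k', _
    rw [← (Fin.consEquiv fun _ : Fin (w.length + 1) => Fin k ⊕ Fin k').sum_comp,
      Fintype.sum_prod_type, Finset.smul_sum]
    refine Finset.sum_congr rfl fun ε _ => ?_
    rw [ih, Finset.smul_sum]
    refine Finset.sum_congr rfl fun α _ => ?_
    rw [smul_smul, ← sgn_add]
    congr 1
    · congr 1
      refine Eq.trans ?_ (Fin.sum_univ_succ _).symm
      congr 1
    · congr 1
      refine Eq.trans ?_ List.ofFn_succ.symm
      congr 1

/-- Telescoping of the parities `p i + p (i + 1)` of the matrix units that have passed a letter. -/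
theorem sum_passed_parities (r : ℕ) : ∀ (p : Fin (r + 1) → ZMod 2) (q : Fin r → ZMod 2),
    (∑ i : Fin r, ∑ j : Fin r, if i < j then (p i.castSucc + p i.succ) * q j else 0) =
      ∑ j, (p 0 + p j.castSucc) * q j := by
  induction r with
  | zero => intro p q; simp
  | succ r ih =>
    intro p q
    simp only [Fin.sum_univ_succ (n := r)]
    have h := ih (fun i => p i.succ) (fun i => q i.succ)
    simp only [Fin.succ_lt_succ_iff, lt_self_iff_false, if_false, Fin.succ_pos, if_true, zero_add,
      Fin.not_lt_zero, Fin.castSucc_zero, CharTwo.add_self_eq_zero, zero_mul] at h ⊢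
    simp only [← Fin.succ_castSucc]
    rw [h, ← Finset.sum_add_distrib]
    refine Finset.sum_congr rfl fun j _ => ?_
    rw [← add_mul, Fin.succ_zero_eq_one, ← add_assoc, add_assoc (p 0),
      CharTwo.add_self_eq_zero, add_zero]

theorem apply_finRotate_symm {X : Type*} (r : ℕ) (g : Fin (r + 1) → X) (i : Fin (r + 1)) :
    g ((finRotate (r + 1)).symm i) =
      (Fin.cons (g (Fin.last r)) g : Fin (r + 2) → X) i.castSucc := by
  obtain ⟨j, rfl⟩ := (finRotate (r + 1)).surjective i
  rw [Equiv.symm_apply_apply]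
  induction j using Fin.lastCases with
  | last => rw [finRotate_last]; rfl
  | cast j =>
    rw [finRotate_of_lt (by simp)]
    exact (Fin.cons_succ (α := fun _ => X) (g (Fin.last r)) g j.castSucc).symm

/-- The Koszul sign of `traceWord`, regrouped as the product of the sign in `loop` and of the signs
of the letters in `chain`; `g` gives the parities of the indices and `q` those of the letters. -/
theorem traceWord_sign (r : ℕ) (g : Fin (r + 1) → ZMod 2) (q : Fin (r + 1) → ZMod 2) :
    (∑ i : Fin (r + 1), if (i : ℕ) + 1 < r + 1 then g i else 0) +
      ∑ i : Fin (r + 1), ∑ j : Fin (r + 1),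
        (if i < j then (g ((finRotate (r + 1)).symm i) + g i) * q j else 0) =
    g (Fin.last r) * (∑ i, q i + 1) + ∑ i, (q i + 1) *
      (Fin.cons (g (Fin.last r)) g : Fin (r + 2) → ZMod 2) i.castSucc := by
  have h := sum_passed_parities (r + 1) (Fin.cons (g (Fin.last r)) g) q
  simp only [Fin.cons_succ, Fin.cons_zero] at h
  simp only [apply_finRotate_symm]
  rw [h, Fin.sum_univ_castSucc]
  simp only [Fin.val_castSucc, Fin.val_last, lt_irrefl, if_false, add_zero, add_lt_add_iff_right,
    Fin.is_lt, if_true]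
  simp only [add_mul, one_mul, Finset.sum_add_distrib, mul_add, mul_one, Finset.mul_sum]
  rw [Fin.sum_univ_succ (fun i => (Fin.cons (g (Fin.last r)) g : Fin (r + 2) → ZMod 2) i.castSucc)]
  simp only [Fin.castSucc_zero, Fin.cons_zero, ← Fin.succ_castSucc, Fin.cons_succ]
  simp only [mul_comm (q _)]
  linear_combination (-1 : ZMod 2) * CharTwo.add_self_eq_zero (g (Fin.last r))

theorem wp_eq_sum (w : List ι) (lp : ι → ZMod 2) : wp lp w = ∑ i : Fin w.length, lp (w.get i) := by
  induction w with
  | nil => rfl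
  | cons a w ih => rw [wp_cons, ih]; exact (Fin.sum_univ_succ fun i => lp ((a :: w).get i)).symm

theorem loop_nil (f : List (GlLetter ι k k') → A) (hf : f [] = 0) : V.loop f [] = 0 := by
  simp [loop, chain, hf]

theorem traceWord_eq_loop (w : List ι) :
    V.traceWord k k' w = V.loop (fun x => (V.tensorGL k k').cword x) (closed k k' w) := by
  cases w with
  | nil =>
    rw [closed, List.map_nil, loop_nil _ _ word_nil]
    simp [traceWord, word_nil]
  | cons a z =>
    rw [loop]
    simp only [chain_closed_eq_sum, Finset.smul_sum]
    rw [Finset.sum_comm]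
    refine Finset.sum_congr rfl fun α _ => ?_
    rw [Finset.sum_eq_single (α (Fin.last z.length)) (fun β _ hβ => ?_) (by simp)]
    · change Fin (z.length + 1) → Fin k ⊕ Fin k' at α
      have hl : (Fin.cons (α (Fin.last z.length)) α : Fin (z.length + 2) → Fin k ⊕ Fin k')
          (Fin.last (a :: z).length) = α (Fin.last z.length) := rfl
      have hc : ∀ i : Fin (z.length + 1), glPar ((Fin.cons (α (Fin.last z.length)) α :
          Fin (z.length + 2) → Fin k ⊕ Fin k') i.castSucc) =
          (Fin.cons (glPar (α (Fin.last z.length))) (fun i => glPar (α i)) :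
            Fin (z.length + 2) → ZMod 2) i.castSucc := fun i =>
        congrFun (Fin.comp_cons glPar (α (Fin.last z.length)) α) i.castSucc
      have h := traceWord_sign z.length (fun i => glPar (α i)) (fun i => V.letter ((a :: z).get i))
      simp only [← hc] at h
      rw [if_pos hl, smul_smul, ← sgn_add, wp_closed, wp_eq_sum]
      congr 1
      · exact congrArg (sgn K) h
      · congr 2
        funext i
        exact congrArg (fun y => ((a :: z).get i, y, α i)) (apply_finRotate_symm z.length α i)
    · have hl : (Fin.cons β α : Fin (z.length + 2) → Fin k ⊕ Fin k')
          (Fin.last (a :: z).length) ≠ β := fun h => hβ h.symm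
      rw [if_neg hl, smul_zero, smul_zero]

end traces

/-! ### The trace of glued and of dissected words -/

section intertwining

variable {K : Type*} [Field K] {ι : Type*} {k k' : ℕ} (V : EvenScalarSpace K ι)
  {A : Type*} [AddCommGroup A] [Module K A]

theorem cword_tensorGL_append (x y : List (GlLetter ι k k')) :
    (V.tensorGL k k').cword (x ++ y) = sgn K (wp (V.tensorGL k k').letter x *
      wp (V.tensorGL k k').letter y) • (V.tensorGL k k').cword (y ++ x) := word_append x y

theorem loop_cword_hasPar (l : List (ι × Junction k k')) :
    HasPar (wp (V.mixedLetter k k') l + 1)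
      (V.loop (fun x => (V.tensorGL k k').cword x) l) := by
  intro v
  refine ((V.map_loop (LinearMap.mulRight K ((V.tensorGL k k').cword v)) _ l).trans ?_).trans
    (congrArg _ (V.map_loop (LinearMap.mulLeft K ((V.tensorGL k k').cword v)) _ l)).symm
  rw [← loop_smul]
  refine V.loop_congr fun x _ hx => ?_
  rw [← hx]
  exact word_comm x v

theorem loop_cword_comm (l l' : List (ι × Junction k k')) :
    V.loop (fun x => (V.tensorGL k k').cword x) l * V.loop (fun x => (V.tensorGL k k').cword x) l' =
      sgn K ((wp (V.mixedLetter k k') l + 1) * (wp (V.mixedLetter k k') l' + 1)) •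
        (V.loop (fun x => (V.tensorGL k k').cword x) l' *
          V.loop (fun x => (V.tensorGL k k').cword x) l) := by
  set p := V.loop (fun x => (V.tensorGL k k').cword x) l with hp
  refine ((V.map_loop (LinearMap.mulLeft K p) _ l').trans ?_).trans
    (congrArg _ (V.map_loop (LinearMap.mulRight K p) _ l')).symm
  rw [← loop_smul]
  refine V.loop_congr fun x _ hx => ?_
  rw [← hx]
  exact V.loop_cword_hasPar l x

theorem closed_append (u v : List ι) :
    closed k k' (u ++ v) = closed k k' u ++ closed k k' v := List.map_append

theorem closed_take (w : List ι) (i : ℕ) :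
    (closed k k' w).take i = closed k k' (w.take i) := List.map_take.symm

theorem closed_drop (w : List ι) (i : ℕ) :
    (closed k k' w).drop i = closed k k' (w.drop i) := List.map_drop.symm

theorem closed_length (w : List ι) : (closed k k' w).length = w.length := List.length_map _

/-- The algebra map `F(V) → F(V ⊗ gl(k|k'))` that sends a cyclic word to its super trace. -/
def traceHom (k k' : ℕ) : V.F →ₐ[K] (V.tensorGL k k').F :=
  RingQuot.liftAlgHom K
    ⟨FreeAlgebra.lift K fun w => V.loop (fun x => (V.tensorGL k k').cword x) (closed k k' w), by
      intro x y h
      induction h with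
      | empty =>
        rw [map_zero, FreeAlgebra.lift_ι_apply]
        exact V.loop_nil _ word_nil
      | rot a u =>
        simp only [FreeAlgebra.lift_ι_apply, map_smul]
        rw [← List.singleton_append, closed_append, closed_append,
          V.loop_append V.cword_tensorGL_append, wp_closed, wp_closed, wp_cons, wp_nil, add_zero]
      | comm u v =>
        simp only [FreeAlgebra.lift_ι_apply, map_mul, map_smul]
        rw [loop_cword_comm, wp_closed, wp_closed]⟩

theorem traceHom_cword (w : List ι) : V.traceHom k k' (V.cword w) =
    V.loop (fun x => (V.tensorGL k k').cword x) (closed k k' w) := by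
  simp [traceHom, cword, word]

theorem omega_tensorGL (a b : ι) (β ε δ η : Fin k ⊕ Fin k') :
    (V.tensorGL k k').omega (a, β, ε) (b, δ, η) =
      if ε = δ ∧ β = η then
        sgn K (glPar ε + (glPar β + glPar ε) * (V.letter b + 1)) * V.omega a b else 0 := by
  have hb : V.letter b + 1 = V.parity b := by
    rw [letter, add_assoc, CharTwo.add_self_eq_zero, add_zero]
  simp only [omega, tensorGL, superTrace_single_mul_single, hb]
  split_ifs with h
  · simp only [sgn_add]
    linear_combination sgn K (V.parity a) * sgn K (glPar ε) *
      sgn K ((glPar β + glPar ε) * V.parity b) * V.form a b * sgn_mul_self K (glPar β)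
  · rw [mul_zero, mul_zero]

theorem chain_mul {R : Type*} [Ring R] [Algebra K R]
    (F G : List (GlLetter ι k k') → (Fin k ⊕ Fin k') → R) (β γ : Fin k ⊕ Fin k')
    (l l' : List (ι × Junction k k')) :
    V.chain (fun x e => V.chain (fun y e' => F x e * G y e') γ l') β l =
      V.chain F β l * V.chain G γ l' := by
  rw [← LinearMap.mulRight_apply (R := K), map_chain]
  congr 1
  funext x e
  rw [LinearMap.mulRight_apply, ← LinearMap.mulLeft_apply (R := K), map_chain]
  rfl

theorem loop_cons (f : List (GlLetter ι k k') → A) (a : ι) (l : List (ι × Junction k k')) :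
    V.loop f ((a, none) :: l) = ∑ β, ∑ γ,
      sgn K (glPar β * (V.letter a + wp (V.mixedLetter k k') l + 1) +
        (V.letter a + 1) * glPar β) •
        V.chain (fun x e => if e = β then f ((a, β, γ) :: x) else 0) γ l := by
  rw [loop]
  refine Finset.sum_congr rfl fun β _ => ?_
  rw [chain_cons, smul_smul, ← sgn_add, wp_cons, mixedLetter, junctionPar, add_zero,
    junctionSum, Finset.smul_sum]

/-- The super trace of the gluing of two words at their first letters. -/
theorem loop_glueHead (u v : List ι) :
    V.loop (fun x => V.loop (fun y => (V.tensorGL k k').glueHead x y) (closed k k' v))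
      (closed k k' u) = V.traceHom k k' (V.glueHead u v) := by
  cases u with
  | nil =>
    rw [glueHead, map_zero]
    · refine V.loop_nil _ ?_
      simp [glueHead, loop, chain_zero]
    · simp
  | cons a x =>
  cases v with
  | nil =>
    rw [glueHead, map_zero]
    · simp [glueHead, loop, chain_zero, closed, chain]
    · simp
  | cons b y =>
  rw [glueHead, map_smul, traceHom_cword, closed_append]
  simp only [closed, List.map_cons]
  change V.loop (fun z => V.loop (fun t => (V.tensorGL k k').glueHead z t)
    ((b, none) :: closed k k' y)) ((a, none) :: closed k k' x) =
    _ • V.loop _ (closed k k' x ++ closed k k' y)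
  have h1 : ∀ (β γ : Fin k ⊕ Fin k'),
      V.chain (fun z e => if e = β then V.loop (fun t => (V.tensorGL k k').glueHead
        ((a, β, γ) :: z) t) ((b, none) :: closed k k' y) else 0) γ (closed k k' x) =
      V.chain (fun z e => if e = β then
        (sgn K (glPar γ * (V.letter b + wp V.letter y + 1) + (V.letter b + 1) * glPar γ +
          ((V.letter a + (glPar β + glPar γ)) * (wp V.letter x + glPar γ + glPar β) +
          ((V.letter a + (glPar β + glPar γ)) + (wp V.letter x + glPar γ + glPar β))) +
          (glPar γ + (glPar β + glPar γ) * (V.letter b + 1))) * V.omega a b) •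
        V.chain (fun t e' => if e' = γ then (V.tensorGL k k').cword (z ++ t) else 0) e
          (closed k k' y) else 0) γ (closed k k' x) := by
    intro β γ
    refine V.chain_congr _ fun z e hz hp => ?_
    split_ifs with he
    · subst he
      -- The form contracts `(a, e, γ)` with `(b, γ, e)` only.
      rw [loop_cons, Finset.sum_eq_single γ (fun δ _ hδ => ?_) (by simp),
        Finset.sum_eq_single e (fun δ _ hδ => ?_) (by simp), ← chain_smul, ← chain_smul]
      · congr 1
        funext t e'
        rw [wp_closed]
        split_ifs with he'
        · subst he'
          rw [glueHead, omega_tensorGL, if_pos ⟨rfl, rfl⟩, tensorGL_letter, hp, wp_closed,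
            smul_smul]
          congr 1
          simp only [sgn_add]
          ring
        · simp
      · simp only [glueHead, omega_tensorGL, hδ.symm, and_false, if_false, mul_zero, zero_smul,
          ite_self, chain_zero, smul_zero]
      · simp only [glueHead, omega_tensorGL, hδ.symm, false_and, if_false, mul_zero, zero_smul,
          ite_self, chain_zero, smul_zero, Finset.sum_const_zero]
    · rfl
  rw [loop_cons, Finset.sum_comm, loop, Finset.smul_sum]
  refine Finset.sum_congr rfl fun γ _ => ?_
  simp only [h1, chain_append, ← chain_smul]
  rw [← chain_sum]
  refine V.chain_congr _ fun z e hz hp => ?_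
  rw [Finset.sum_eq_single e (fun β _ hβ => by rw [if_neg hβ.symm, smul_zero]) (by simp),
    if_pos rfl]
  simp only [chain_smul, smul_smul, wp_append, wp_closed]
  -- The signs agree only if `a` and `b` have equal parity; otherwise `ω(a, b) = 0`.
  by_cases h : V.letter a = V.letter b
  · congr 1
    rw [← mul_assoc, ← sgn_add, mul_right_comm (sgn K _) (V.omega a b), ← sgn_add]
    congr 2
    rw [h]
    generalize V.letter b = p
    generalize wp V.letter x = q
    generalize wp V.letter y = r
    generalize glPar γ = s
    generalize glPar e = t
    revert p q r s t
    decide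
  · simp [V.omega_even h]

theorem loop_rotSum_comm {κ : Type*} (lp : κ → ZMod 2) (f : List (GlLetter ι k k') → List κ → A)
    (w : List κ) (l : List (ι × Junction k k')) :
    V.loop (fun x => rotSum (K := K) lp (f x) w) l =
      rotSum (K := K) lp (fun v => V.loop (fun x => f x v) l) w := by
  simp only [rotSum, loop_sum, loop_smul]

theorem rotSum_closed (f : List (ι × Junction k k') → A) (w : List ι) :
    rotSum (K := K) (V.mixedLetter k k') f (closed k k' w) =
      rotSum (K := K) V.letter (fun v => f (closed k k' v)) w := by
  simp only [rotSum, ← closed_append, closed_take, closed_drop, wp_closed, closed_length]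

/-- The super trace of the gluing of two words. -/
theorem loop_glue (u v : List ι) :
    V.loop (fun x => V.loop (fun y => (V.tensorGL k k').glue x y) (closed k k' v))
      (closed k k' u) = V.traceHom k k' (V.glue u v) := by
  have h1 : ∀ x, V.loop (fun y => (V.tensorGL k k').glue x y) (closed k k' v) =
      rotSum (K := K) V.letter (fun v => rotSum (K := K) (V.tensorGL k k').letter
        (fun z => V.loop (fun y => (V.tensorGL k k').glueHead z y) (closed k k' v)) x) v := by
    intro x
    simp only [glue]
    simp only [fun y => rotSum_comm (K := K) (lp := (V.tensorGL k k').letter)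
      (fun z t => (V.tensorGL k k').glueHead z t) x y]
    rw [loop_rotSum, rotSum_closed]
    simp only [loop_rotSum_comm]
  simp only [h1]
  rw [loop_rotSum_comm]
  simp only [loop_rotSum, rotSum_closed, loop_glueHead]
  rw [rotSum_comm, glue, ← AlgHom.toLinearMap_apply, rotSum_map]
  simp only [rotSum_map, AlgHom.toLinearMap_apply]

/-- The super trace of the superderivation `glueOp`. -/
theorem loop_glueOp (w : List ι) (y : V.F) :
    V.loop (fun x => (V.tensorGL k k').glueOp x (V.traceHom k k' y)) (closed k k' w) =
      V.traceHom k k' (V.glueOp w y) := by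
  induction y using induction_words with
  | one =>
    simp only [map_one, glueOp_one]
    simp [loop, chain_zero]
  | smul c x hx => simp only [map_smul, loop_smul, hx]
  | add x y hx hy => simp only [map_add, loop_add, hx, hy]
  | mul v y hy =>
    have h1 : ∀ x, (V.tensorGL k k').glueOp x (V.traceHom k k' (V.cword v * y)) =
        V.loop (fun q => (V.tensorGL k k').glue x q) (closed k k' v) * V.traceHom k k' y +
        sgn K (wp (V.tensorGL k k').letter x * (wp V.letter v + 1)) •
          (V.traceHom k k' (V.cword v) * (V.tensorGL k k').glueOp x (V.traceHom k k' y)) := by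
      intro x
      rw [map_mul, traceHom_cword]
      have h2 := V.map_loop ((V.tensorGL k k').glueOp x ∘ₗ
        LinearMap.mulRight K (V.traceHom k k' y)) (fun q => (V.tensorGL k k').cword q)
        (closed k k' v)
      have h3 := V.map_loop (LinearMap.mulRight K (V.traceHom k k' y))
        (fun q => (V.tensorGL k k').glue x q) (closed k k' v)
      have h4 := V.map_loop (LinearMap.mulRight K
        ((V.tensorGL k k').glueOp x (V.traceHom k k' y)))
        (fun q => (V.tensorGL k k').cword q) (closed k k' v)
      simp only [LinearMap.comp_apply, LinearMap.mulRight_apply] at h2 h3 h4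
      rw [h2, h3, h4, ← loop_smul, ← loop_add]
      refine V.loop_congr fun q _ hq => ?_
      rw [glueOp_word_mul, hq, wp_closed]
    have h2 := V.map_loop (LinearMap.mulRight K (V.traceHom k k' y))
      (fun x => V.loop (fun q => (V.tensorGL k k').glue x q) (closed k k' v)) (closed k k' w)
    have h3 := V.map_loop (LinearMap.mulLeft K (V.traceHom k k' (V.cword v)))
      (fun x => (V.tensorGL k k').glueOp x (V.traceHom k k' y)) (closed k k' w)
    simp only [LinearMap.mulRight_apply, LinearMap.mulLeft_apply] at h2 h3
    rw [← cword, glueOp_word_mul, map_add, map_mul _ (V.glue w v), map_smul,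
      map_mul _ (V.cword v) (V.glueOp w y), ← hy, ← loop_glue, h2, h3,
      ← loop_smul, ← loop_add]
    refine V.loop_congr fun x _ hx => ?_
    rw [h1, hx, wp_closed]

/-- The term of `cutHead (a :: (u ++ v))` that contracts `a` with the first letter of `v`. -/
def cutTerm (a : ι) (u : List ι) : List ι → V.F
  | [] => 0
  | b :: v => (sgn K (wp V.letter u * V.letter b + wp V.letter u) * V.omega a b) •
      (V.cword u * V.cword v)

theorem cutHead_cons (a : ι) (x : List ι) :
    V.cutHead (a :: x) = ∑ i ∈ Finset.range x.length, V.cutTerm a (x.take i) (x.drop i) := by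
  rw [Finset.sum_range, cutHead]
  refine Finset.sum_congr rfl fun i _ => ?_
  rw [List.drop_eq_getElem_cons i.2]
  rfl

/-- The super trace of one term of the dissection: the contraction of `a` with `b` closes the
indices on both sides, so that the sum over paths factors into two traces. -/
theorem loop_cutTerm (a b : ι) (u v : List ι) :
    (∑ β, ∑ γ, sgn K (glPar β * (V.letter a + wp V.letter (u ++ b :: v) + 1) +
      (V.letter a + 1) * glPar β) • V.chain (fun x e => if e = β then
        (V.tensorGL k k').cutTerm (a, β, γ) (x.take u.length) (x.drop u.length) else 0) γ
          (closed k k' (u ++ b :: v))) = V.traceHom k k' (V.cutTerm a u (b :: v)) := by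
  rw [cutTerm, map_smul, map_mul, traceHom_cword, traceHom_cword, loop, loop,
    Finset.sum_mul_sum, Finset.sum_comm, Finset.smul_sum]
  refine Finset.sum_congr rfl fun γ _ => ?_
  rw [Finset.smul_sum]
  refine Finset.sum_congr rfl fun β _ => ?_
  rw [smul_mul_smul_comm, smul_smul, ← chain_mul, closed_append, chain_append]
  rw [← chain_smul, ← chain_smul]
  refine V.chain_congr _ fun x e hx hp => ?_
  have hx' : x.length = u.length := by simpa [closed] using hx
  change _ • V.chain _ e ((b, none) :: closed k k' v) = _
  rw [chain_cons, junctionSum]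
  simp only [← hx', List.take_left, List.drop_left, cutTerm, omega_tensorGL]
  -- `(a, β, γ)` is contracted with `(b, e, η)`, so that `e = γ` and `η = β`.
  by_cases he : e = γ
  swap
  · simp only [he, Ne.symm he, false_and, if_false, mul_zero, zero_smul, ite_self, chain_zero,
      smul_zero, Finset.sum_const_zero, zero_mul]
  subst he
  rw [Finset.sum_eq_single β (fun η _ hη => by
    simp only [Ne.symm hη, and_false, if_false, mul_zero, zero_smul, ite_self, chain_zero])
    (by simp)]
  rw [smul_smul, ← chain_smul, ← chain_smul]
  refine congrArg (fun F => V.chain F β (closed k k' v)) (funext fun y => funext fun e' => ?_)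
  by_cases he' : e' = β
  swap
  · simp [he']
  subst he'
  simp only [and_self, if_true]
  rw [smul_smul, hp, tensorGL_letter, wp_closed, wp_closed]
  by_cases h : V.letter a = V.letter b
  · congr 1
    simp only [← mul_assoc, ← sgn_add]
    rw [mul_right_comm, ← sgn_add]
    congr 2
    simp only [wp_append, wp_cons, h]
    generalize V.letter b = p
    generalize wp V.letter u = q
    generalize wp V.letter v = r
    generalize glPar e = s
    generalize glPar e' = t
    revert p q r s t
    decide
  · simp [V.omega_even h]

end intertwining

/-! ### The trace and the Batalin–Vilkovisky equation -/

section master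

variable {K : Type*} [Field K] {ι : Type*} {k k' : ℕ} (V : EvenScalarSpace K ι)
  {A : Type*} [AddCommGroup A] [Module K A]

/-- The super trace of the dissection of a word at its first letter. -/
theorem loop_cutHead (w : List ι) :
    V.loop (fun x => (V.tensorGL k k').cutHead x) (closed k k' w) =
      V.traceHom k k' (V.cutHead w) := by
  cases w with
  | nil => rw [cutHead, map_zero]; exact V.loop_nil _ rfl
  | cons a z =>
    have h : ∀ i ∈ Finset.range z.length, (∑ β, ∑ γ,
        sgn K (glPar β * (V.letter a + wp V.letter z + 1) + (V.letter a + 1) * glPar β) •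
        V.chain (fun x e => if e = β then
          (V.tensorGL k k').cutTerm (a, β, γ) (x.take i) (x.drop i) else 0) γ
          (closed k k' z)) = V.traceHom k k' (V.cutTerm a (z.take i) (z.drop i)) := by
      intro i hi
      have hi' := Finset.mem_range.1 hi
      have h1 := V.loop_cutTerm (k := k) (k' := k') a z[i] (z.take i) (z.drop (i + 1))
      rwa [List.getElem_cons_drop, List.take_append_drop, List.length_take_of_le hi'.le] at h1
    rw [cutHead_cons, map_sum, ← Finset.sum_congr rfl h]
    change V.loop _ ((a, none) :: closed k k' z) = _
    rw [loop_cons]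
    refine Eq.trans (Finset.sum_congr rfl fun β _ => ?_) Finset.sum_comm
    refine Eq.trans (Finset.sum_congr rfl fun γ _ => ?_) Finset.sum_comm
    rw [← Finset.smul_sum, ← chain_sum, wp_closed]
    congr 1
    refine V.chain_congr _ fun x e hx _ => ?_
    rw [closed_length] at hx
    split_ifs
    · rw [cutHead_cons, hx]
    · exact Finset.sum_const_zero.symm

/-- The super trace of the dissection of a word. -/
theorem loop_cut (w : List ι) :
    V.loop (fun x => (V.tensorGL k k').cut x) (closed k k' w) =
      V.traceHom k k' (V.cut w) := by
  simp only [cut, loop_smul, loop_rotSum, rotSum_closed, loop_cutHead, map_smul]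
  rw [← AlgHom.toLinearMap_apply, rotSum_map]
  rfl

/-- The super trace intertwines the Batalin–Vilkovisky operators. -/
theorem traceHom_bv (y : V.F) :
    V.traceHom k k' (V.bv y) = (V.tensorGL k k').bv (V.traceHom k k' y) := by
  induction y using induction_words with
  | one => simp only [map_one, bv_one, map_zero]
  | smul c x hx => simp only [map_smul, hx]
  | add x y hx hy => simp only [map_add, hx, hy]
  | mul w y hy =>
    have h1 := V.map_loop ((V.tensorGL k k').bv ∘ₗ LinearMap.mulRight K (V.traceHom k k' y))
      (fun q => (V.tensorGL k k').cword q) (closed k k' w)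
    have h2 := V.map_loop (LinearMap.mulRight K (V.traceHom k k' y))
      (fun q => (V.tensorGL k k').cut q) (closed k k' w)
    have h3 := V.map_loop (LinearMap.mulRight K ((V.tensorGL k k').bv (V.traceHom k k' y)))
      (fun q => (V.tensorGL k k').cword q) (closed k k' w)
    simp only [LinearMap.comp_apply, LinearMap.mulRight_apply] at h1 h2 h3
    rw [← cword, bv_word_mul, map_add (V.traceHom k k'), map_add (V.traceHom k k'), map_smul,
      map_mul _ (V.cut w), map_mul _ (V.cword w), map_mul _ (V.cword w), hy, traceHom_cword,
      ← loop_glueOp, ← loop_cut, h1, h2, h3, ← loop_smul, ← loop_add, ← loop_add]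
    refine V.loop_congr fun x _ hx => ?_
    rw [bv_word_mul, hx, wp_closed]

theorem parityInv_word {lp : ι → ZMod 2} (w : List ι) :
    parityInv K lp (word K lp w) = sgn K (wp lp w + 1) • word K lp w := by
  simp [parityInv, word]

theorem traceHom_parityInv (y : V.F) :
    V.traceHom k k' (parityInv K V.letter y) =
      parityInv K (V.tensorGL k k').letter (V.traceHom k k' y) := by
  induction y using induction_words with
  | one => simp only [map_one]
  | smul c x hx => simp only [map_smul, hx]
  | add x y hx hy => simp only [map_add, hx, hy]
  | mul w y hy =>
    have h := V.map_loop (parityInv K (V.tensorGL k k').letter).toLinearMap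
      (fun q => (V.tensorGL k k').cword q) (closed k k' w)
    simp only [AlgHom.toLinearMap_apply] at h
    rw [map_mul, map_mul, map_mul, map_mul, hy, parityInv_word, map_smul, ← cword, traceHom_cword,
      h, ← loop_smul]
    congr 1
    refine V.loop_congr fun x _ hx => ?_
    rw [parityInv_word, hx, wp_closed]

theorem traceHom_bracket (x y : V.F) :
    V.traceHom k k' (V.bracket x y) =
      (V.tensorGL k k').bracket (V.traceHom k k' x) (V.traceHom k k' y) := by
  simp only [bracket, map_sub, map_mul, traceHom_bv, traceHom_parityInv]

/-- The left hand side `ħ Δ S + ½ {S, S}` of the Batalin–Vilkovisky equation. -/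
noncomputable def master (S : V.F⟦X⟧) : V.F⟦X⟧ :=
  PowerSeries.X * V.bvSeries S + (2⁻¹ : K) • V.bracketSeries S S

theorem coeff_smul_series {R : Type*} [Ring R] [Algebra K R] (c : K) (S : R⟦X⟧) (n : ℕ) :
    PowerSeries.coeff n (c • S) = c • PowerSeries.coeff n S := rfl

theorem map_master (S : V.F⟦X⟧) :
    PowerSeries.map (V.traceHom k k' : V.F →+* (V.tensorGL k k').F) (V.master S) =
      (V.tensorGL k k').master
        (PowerSeries.map (V.traceHom k k' : V.F →+* (V.tensorGL k k').F) S) := by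
  ext n
  rw [PowerSeries.coeff_map, master, master, map_add, map_add, map_add, coeff_smul_series,
    coeff_smul_series]
  congr 1
  · cases n with
    | zero => simp
    | succ n =>
      rw [PowerSeries.coeff_succ_X_mul, PowerSeries.coeff_succ_X_mul, bvSeries, bvSeries,
        PowerSeries.coeff_mk, PowerSeries.coeff_mk, PowerSeries.coeff_map]
      exact V.traceHom_bv _
  · rw [bracketSeries, bracketSeries, PowerSeries.coeff_mk, PowerSeries.coeff_mk]
    refine (map_smul (V.traceHom k k') _ _).trans ?_
    rw [map_sum]
    simp only [traceHom_bracket, PowerSeries.coeff_map]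
    rfl

theorem IsSolution.map_traceHom {S : V.F⟦X⟧} (hS : V.IsSolution S) :
    (V.tensorGL k k').IsSolution
      (PowerSeries.map (V.traceHom k k' : V.F →+* (V.tensorGL k k').F) S) := by
  change (V.tensorGL k k').master _ = 0
  rw [← map_master, show V.master S = 0 from hS, map_zero]

theorem IsEven.map_traceHom {S : V.F⟦X⟧} (hS : V.IsEven S) :
    (V.tensorGL k k').IsEven
      (PowerSeries.map (V.traceHom k k' : V.F →+* (V.tensorGL k k').F) S) := by
  intro n
  rw [PowerSeries.coeff_map]
  exact (V.traceHom_parityInv _).symm.trans (congrArg _ (hS n))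

/-! ### Restriction of the alphabet and injectivity of the trace -/

section restriction

variable {κ κ' : Type*} {lp : κ → ZMod 2} {lp' : κ' → ZMod 2}

/-- The image of a word under a partial map `m` of alphabets: zero if `m` is not defined on all of
its letters; otherwise the image is rescaled by a factor that depends on the length only. -/
def restrictWord (K : Type*) [Field K] (lp' : κ' → ZMod 2) (m : κ → Option κ') (c : ℕ → K)
    (x : List κ) : CycAlg K lp' :=
  if ∀ a ∈ x, (m a).isSome then c x.length • word K lp' (x.filterMap m) else 0

theorem wp_filterMap {m : κ → Option κ'} (hm : ∀ a b, m a = some b → lp' b = lp a) {x : List κ}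
    (hx : ∀ a ∈ x, (m a).isSome) : wp lp' (x.filterMap m) = wp lp x := by
  induction x with
  | nil => rfl
  | cons a x ih =>
    obtain ⟨b, hb⟩ := Option.isSome_iff_exists.1 (hx a (by simp))
    rw [List.filterMap_cons_some hb, wp_cons, wp_cons, hm a b hb,
      ih fun a ha => hx a (by simp [ha])]

theorem restrictWord_rot {m : κ → Option κ'} (hm : ∀ a b, m a = some b → lp' b = lp a) (c : ℕ → K)
    (x y : List κ) : restrictWord K lp' m c (x ++ y) =
      sgn K (wp lp x * wp lp y) • restrictWord K lp' m c (y ++ x) := by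
  have h : (∀ a ∈ x ++ y, (m a).isSome) ↔ ∀ a ∈ y ++ x, (m a).isSome := by
    simp only [List.mem_append, or_comm]
  by_cases h1 : ∀ a ∈ x ++ y, (m a).isSome
  · rw [restrictWord, restrictWord, if_pos h1, if_pos (h.1 h1), List.filterMap_append, word_append,
      wp_filterMap hm fun a ha => h1 a (List.mem_append_left _ ha),
      wp_filterMap hm fun a ha => h1 a (List.mem_append_right _ ha), List.filterMap_append,
      smul_comm, List.length_append, List.length_append, add_comm]
  · rw [restrictWord, restrictWord, if_neg h1, if_neg (mt h.2 h1), smul_zero]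

theorem restrictWord_comm {m : κ → Option κ'} (hm : ∀ a b, m a = some b → lp' b = lp a) (c : ℕ → K)
    (x y : List κ) : restrictWord K lp' m c x * restrictWord K lp' m c y =
      sgn K ((wp lp x + 1) * (wp lp y + 1)) •
        (restrictWord K lp' m c y * restrictWord K lp' m c x) := by
  unfold restrictWord
  split_ifs with h1 h2
  · rw [smul_mul_smul_comm, smul_mul_smul_comm, word_comm, wp_filterMap hm h1, wp_filterMap hm h2,
      smul_comm, mul_comm (c _)]
  all_goals simp

/-- The algebra map given by `restrictWord`, for a partial map that preserves parities. -/
def restrictHom (m : κ → Option κ') (hm : ∀ a b, m a = some b → lp' b = lp a) (c : ℕ → K) :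
    CycAlg K lp →ₐ[K] CycAlg K lp' :=
  RingQuot.liftAlgHom K
    ⟨FreeAlgebra.lift K (restrictWord K lp' m c), by
      intro x y h
      induction h with
      | empty => simp [restrictWord, word_nil]
      | rot a u =>
        simp only [FreeAlgebra.lift_ι_apply, map_smul]
        rw [← List.singleton_append, restrictWord_rot hm, wp_cons, wp_nil, add_zero]
      | comm u v =>
        simp only [FreeAlgebra.lift_ι_apply, map_mul, map_smul]
        exact restrictWord_comm hm c u v⟩

theorem restrictHom_word (m : κ → Option κ') (hm : ∀ a b, m a = some b → lp' b = lp a) (c : ℕ → K)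
    (w : List κ) : restrictHom m hm c (word K lp w) = restrictWord K lp' m c w := by
  simp [restrictHom, word]

end restriction

/-- The partial map that keeps the letters `a ⊗ E_{αα}` for one fixed `α`. -/
def diagLetter (α : Fin k ⊕ Fin k') (x : GlLetter ι k k') : Option ι :=
  if x.2.1 = α ∧ x.2.2 = α then some x.1 else none

theorem letter_of_diagLetter (α : Fin k ⊕ Fin k') (x : GlLetter ι k k') (b : ι)
    (h : diagLetter α x = some b) : V.letter b = (V.tensorGL k k').letter x := by
  unfold diagLetter at h
  split_ifs at h with h1
  rw [tensorGL_letter, h1.1, h1.2, CharTwo.add_self_eq_zero, add_zero, ← Option.some.inj h]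

/-- The retraction of `traceHom` that keeps only the letters `a ⊗ E_{αα}`. The factor `±1` undoes
the sign that the word in these letters has in the trace. -/
def diagHom (α : Fin k ⊕ Fin k') : (V.tensorGL k k').F →ₐ[K] V.F :=
  restrictHom (diagLetter α) (V.letter_of_diagLetter α) fun r => sgn K (glPar α * (r + 1))

/-- If `f` vanishes outside the words in the letters `a ⊗ E_{αα}`, one term of the sum remains. -/
theorem chain_closed_of_diag (α : Fin k ⊕ Fin k') (w : List ι) :
    ∀ (f : List (GlLetter ι k k') → (Fin k ⊕ Fin k') → A), (∀ x e, e ≠ α → f x e = 0) →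
      (∀ x y z e, y.2.1 ≠ α ∨ y.2.2 ≠ α → f (x ++ y :: z) e = 0) →
      V.chain f α (closed k k' w) = sgn K (glPar α * (wp V.letter w + w.length)) •
        f (w.map fun a => (a, α, α)) α := by
  induction w with
  | nil => intro f _ _; simp [closed, chain, sgn_zero]
  | cons a w ih =>
    intro f h1 h2
    change V.chain f α ((a, none) :: closed k k' w) = _
    rw [chain_cons, junctionSum, Finset.sum_eq_single α (fun ε _ hε => ?_) (by simp), ih]
    · rw [smul_smul, ← sgn_add]
      congr 2
      simp only [wp_cons, List.length_cons, Nat.cast_succ]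
      ring
    · exact fun x e he => h1 _ _ he
    · exact fun x y z e h => h2 ((a, α, α) :: x) y z e h
    · refine Eq.trans (congrArg (fun F => V.chain F ε (closed k k' w)) ?_) (V.chain_zero ε _)
      exact funext fun x => funext fun e => h2 [] (a, α, ε) x e (Or.inr hε)

theorem diagHom_traceHom (α : Fin k ⊕ Fin k') (y : V.F) :
    V.diagHom α (V.traceHom k k' y) = y := by
  have h2 : ∀ (x : List (GlLetter ι k k')) y z, y.2.1 ≠ α ∨ y.2.2 ≠ α →
      V.diagHom α ((V.tensorGL k k').cword (x ++ y :: z)) = 0 := by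
    intro x y z h
    rw [diagHom, restrictHom_word, restrictWord, if_neg]
    intro h3
    have := h3 y (by simp)
    rw [diagLetter, if_neg (by tauto)] at this
    simp at this
  have h : ∀ w, V.diagHom α (V.traceHom k k' (V.cword w)) = V.cword w := by
    intro w
    rw [traceHom_cword]
    refine (V.map_loop (V.diagHom α).toLinearMap _ _).trans ?_
    simp only [AlgHom.toLinearMap_apply]
    cases w with
    | nil => exact (V.loop_nil _ ((congrArg _ word_nil).trans (map_zero _))).trans word_nil.symm
    | cons a w =>
    rw [loop, Finset.sum_eq_single α (fun β _ hβ => ?_) (by simp), chain_closed_of_diag, if_pos rfl,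
      wp_closed, diagHom, restrictHom_word, restrictWord, if_pos]
    · rw [smul_smul, smul_smul, ← sgn_add, ← sgn_add, List.filterMap_map]
      have h3 : (diagLetter α ∘ fun a : ι => (a, α, α)) = some := by
        funext a; simp [diagLetter]
      rw [h3, List.filterMap_some, List.length_map]
      refine Eq.trans (congrArg (· • _) (congrArg (sgn K) ?_)) (by rw [sgn_zero, one_smul])
      generalize wp V.letter (a :: w) = p
      generalize ((a :: w).length : ZMod 2) = q
      generalize glPar α = r
      revert p q r
      decide
    · simp [diagLetter]
    · intro x e he; rw [if_neg he]
    · intro x y z e h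
      rw [h2 x y z h, ite_self]
    · refine smul_eq_zero_of_right _ ?_
      change V.chain _ β ((a, none) :: closed k k' w) = 0
      rw [chain_cons, junctionSum]
      refine smul_eq_zero_of_right _ (Finset.sum_eq_zero fun ε _ => ?_)
      refine Eq.trans (congrArg (fun F => V.chain F ε (closed k k' w)) ?_) (V.chain_zero ε _)
      funext x e
      rw [← List.nil_append ((a, β, ε) :: x), h2 _ _ _ (Or.inl hβ), ite_self]
  induction y using induction_words with
  | one => simp only [map_one]
  | smul c x hx => simp only [map_smul, hx]
  | add x y hx hy => simp only [map_add, hx, hy]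
  | mul w y hy => rw [map_mul, map_mul, hy, h]

theorem diagHom_parityInv (α : Fin k ⊕ Fin k') (y : (V.tensorGL k k').F) :
    V.diagHom α (parityInv K (V.tensorGL k k').letter y) =
      parityInv K V.letter (V.diagHom α y) := by
  induction y using induction_words with
  | one => simp only [map_one]
  | smul c x hx => simp only [map_smul, hx]
  | add x y hx hy => simp only [map_add, hx, hy]
  | mul w y hy =>
    rw [map_mul, map_mul, map_mul, map_mul, hy, parityInv_word, map_smul, diagHom,
      restrictHom_word, restrictWord]
    congr 1
    split_ifs with h
    · rw [map_smul, parityInv_word, wp_filterMap (V.letter_of_diagLetter α) h, smul_comm]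
    · rw [smul_zero, map_zero]

end master

/-! ### Invariance of the trace -/

section symmetry

variable {K : Type*} [Field K] {ι : Type*} {k k' : ℕ} (V : EvenScalarSpace K ι)
  {A : Type*} [AddCommGroup A] [Module K A]

/-- `f` of the word whose first letter has its left index changed from `δ` to `γ`. The sign is the
quotient of the signs of the two letters in `chain`. -/
def relabel (f : List (GlLetter ι k k') → A) (γ δ : Fin k ⊕ Fin k') :
    List (GlLetter ι k k') → A
  | [] => 0
  | x :: y => if x.2.1 = δ then
      sgn K ((glPar γ + glPar δ) * (V.letter x.1 + 1)) • f ((x.1, γ, x.2.2) :: y) else 0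

/-- `f` of the word whose first letter has its right index changed from `γ` to `δ` and is moved to
the end; the sign is that of inserting `t ⊗ E_{γδ}` to the right of the first letter and of
rotating `t` to the front. -/
def rightMove (f : List (GlLetter ι k k') → A) (γ δ : Fin k ⊕ Fin k') :
    List (GlLetter ι k k') → A
  | [] => 0
  | x :: y => if x.2.2 = γ then
      sgn K (glPar γ + glPar δ + (V.letter x.1 + (glPar x.2.1 + glPar δ)) *
        (glPar γ + glPar δ + wp (V.tensorGL k k').letter y)) • f (y ++ [(x.1, x.2.1, δ)]) else 0

/-- The word `x` with the letter `t` in front. -/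
def tWord (γ δ : Fin k ⊕ Fin k') (x : List (GlLetter ι k k')) :
    CycAlg K (V.extLetter k k' γ δ) :=
  word K (V.extLetter k k' γ δ) (none :: x.map some)

/-- The part of the infinitesimal action that replaces the first letter. -/
def headVar (γ δ : Fin k ⊕ Fin k') : List (GlLetter ι k k') → CycAlg K (V.extLetter k k' γ δ)
  | [] => 0
  | x :: y => V.glVarAt γ δ [] x (y.map some)

/-- The two summands of the commutator, rotated so that `t` comes first. -/
theorem headVar_eq (γ δ : Fin k ⊕ Fin k') (x : List (GlLetter ι k k')) :
    V.headVar γ δ x = sgn K (glPar γ + glPar δ) • V.relabel (V.tWord γ δ) γ δ x -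
      V.rightMove (V.tWord γ δ) γ δ x := by
  cases x with
  | nil => simp [headVar, relabel, rightMove]
  | cons x y =>
    rw [headVar, glVarAt, relabel, rightMove]
    congr 1
    · simp only [eq_comm (a := δ)]
      split_ifs with h
      · rw [smul_smul, ← sgn_add]
        congr 2
        generalize V.letter x.1 = p
        generalize glPar γ = q
        generalize glPar δ = r
        revert p q r
        decide
      · rw [smul_zero]
    · split_ifs with h
      · rw [sgn_add K (glPar γ + glPar δ), mul_smul]
        congr 1
        have h1 := word_append (K := K) (lp := V.extLetter k k' γ δ) [some (x.1, x.2.1, δ)]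
          (none :: y.map some)
        rw [wp_cons, wp_cons, wp_nil, add_zero, wp_map_some] at h1
        simp only [extLetter, tensorGL_letter] at h1
        change _ = _ • word K _ (none :: (y ++ [(x.1, x.2.1, δ)]).map some)
        rw [List.map_append, List.map_singleton]
        exact h1
      · rfl

theorem glVarAux_eq_sum (γ δ : Fin k ⊕ Fin k') (w : List (GlLetter ι k k')) :
    ∀ pre : List (GlLetter ι k k'), V.glVarAux γ δ (pre.map some) w =
      ∑ i ∈ Finset.range w.length, sgn K (wp (V.tensorGL k k').letter (pre ++ w.take i) *
        wp (V.tensorGL k k').letter (w.drop i)) •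
          V.headVar γ δ (w.drop i ++ (pre ++ w.take i)) := by
  induction w with
  | nil => intro pre; rfl
  | cons x w ih =>
    intro pre
    have h1 := ih (pre ++ [x])
    rw [List.map_append, List.map_singleton] at h1
    have h2 := V.glVarAt_append γ δ (pre.map some) [] x (w.map some)
    rw [wp_map_some, wp_map_some, wp_nil, zero_add, List.append_nil] at h2
    rw [glVarAux, h1, h2, List.length_cons, Finset.sum_range_succ', add_comm]
    congr 1
    · refine Finset.sum_congr rfl fun i _ => ?_
      simp
    · simp [headVar]

/-- The infinitesimal action is the cyclic symmetrisation of its action on the first letter. -/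
theorem glVarWord_eq_rotSum (γ δ : Fin k ⊕ Fin k') (w : List (GlLetter ι k k')) :
    V.glVarWord γ δ w = rotSum (K := K) (V.tensorGL k k').letter (V.headVar γ δ) w := by
  exact V.glVarAux_eq_sum γ δ w []

/-- Relabelling the left index of the first letter moves the start of the path. -/
theorem chain_relabel (f : List (GlLetter ι k k') → A) (γ δ η β : Fin k ⊕ Fin k')
    {l : List (ι × Junction k k')} (hl : l ≠ []) :
    V.chain (fun y e => if e = η then V.relabel f γ δ y else 0) β l =
      if β = δ then V.chain (fun y e => if e = η then f y else 0) γ l else 0 := by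
  obtain ⟨x, l, rfl⟩ := List.exists_cons_of_ne_nil hl
  rw [chain_cons]
  split_ifs with hβ
  · subst hβ
    rw [chain_cons]
    simp only [relabel, if_true]
    rw [← junctionSum_smul, ← junctionSum_smul]
    refine junctionSum_congr fun ε β' _ => ?_
    rw [← chain_smul, ← chain_smul]
    refine congrArg (fun F => V.chain F β' l) (funext fun y => funext fun e => ?_)
    split_ifs
    · rw [smul_smul, ← sgn_add]
      congr 2
      generalize V.letter x.1 = p
      generalize glPar γ = q
      generalize glPar β = r
      revert p q r
      decide
    · rw [smul_zero, smul_zero]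
  · simp only [relabel, if_neg hβ, ite_self, chain_zero]
    cases x.2 <;> simp [junctionSum]

theorem loop_relabel (f : List (GlLetter ι k k') → A) (γ δ : Fin k ⊕ Fin k')
    {l : List (ι × Junction k k')} (hl : l ≠ []) :
    V.loop (V.relabel f γ δ) l = sgn K (glPar δ * (wp (V.mixedLetter k k') l + 1)) •
      V.chain (fun y e => if e = δ then f y else 0) γ l := by
  rw [loop, Finset.sum_eq_single δ (fun β _ hβ => ?_) (by simp)]
  · rw [chain_relabel _ _ _ _ _ _ hl, if_pos rfl]
  · rw [chain_relabel _ _ _ _ _ _ hl, if_neg hβ, smul_zero]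

theorem chain_append_closed (F : List (GlLetter ι k k') → (Fin k ⊕ Fin k') → A)
    (β : Fin k ⊕ Fin k') (l : List (ι × Junction k k')) (a : ι) :
    V.chain F β (l ++ [(a, none)]) = V.chain (fun x e => sgn K ((V.letter a + 1) * glPar e) •
      ∑ ε, F (x ++ [(a, e, ε)]) ε) β l := by
  rw [chain_append]
  rfl

theorem loop_rightMove (f : List (GlLetter ι k k') → A) (γ δ : Fin k ⊕ Fin k')
    (x : ι × Junction k k') (l : List (ι × Junction k k')) :
    V.loop (V.rightMove f γ δ) (x :: l) = junctionSum x.2 fun ε β => if ε = γ then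
      sgn K (glPar γ + V.letter x.1 * (glPar γ + glPar β + wp (V.mixedLetter k k') l) +
        glPar δ * wp (V.mixedLetter k k') (x :: l)) •
        V.chain (fun y e => if e = δ then f y else 0) β (l ++ [(x.1, none)]) else 0 := by
  have h : ∀ β : Fin k ⊕ Fin k', sgn K (glPar β * (wp (V.mixedLetter k k') (x :: l) + 1)) •
      V.chain (fun y e => if e = β then V.rightMove f γ δ y else 0) β (x :: l) =
      junctionSum x.2 fun ε β' => V.chain (fun y e => if e = β then if ε = γ then
        sgn K (glPar γ + V.letter x.1 * (glPar γ + glPar β' + wp (V.mixedLetter k k') l) +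
          glPar δ * wp (V.mixedLetter k k') (x :: l)) • sgn K ((V.letter x.1 + 1) * glPar e) •
          f (y ++ [(x.1, e, δ)]) else 0 else 0) β' l := by
    intro β
    rw [chain_cons, ← junctionSum_smul, ← junctionSum_smul]
    refine junctionSum_congr fun ε β' hj => ?_
    rw [← chain_smul, ← chain_smul]
    refine V.chain_congr l fun y e _ hy => ?_
    by_cases he : e = β
    swap
    · simp [he]
    subst he
    by_cases hε : ε = γ
    swap
    · simp [hε, rightMove]
    subst hε
    simp only [rightMove, if_true]
    rw [hy, wp_cons, mixedLetter, ← hj]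
    simp only [smul_smul, ← sgn_add]
    congr 2
    generalize V.letter x.1 = p
    generalize wp (V.mixedLetter k k') l = q
    generalize glPar ε = r
    generalize glPar δ = s
    generalize glPar e = t
    generalize glPar β' = u
    revert p q r s t u
    decide
  rw [loop, Finset.sum_congr rfl fun β _ => h β]
  rw [sum_junctionSum]
  refine junctionSum_congr fun ε β' _ => ?_
  rw [← chain_sum]
  simp only [Finset.sum_ite_eq, Finset.mem_univ, if_true, chain_append_closed, chain_ite,
    chain_smul, Finset.sum_ite_eq']

/-- The cyclic symmetrisation of a difference `J w - J (rotated w)` telescopes to zero. -/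
theorem rotSum_sub_rot (lp : ι → ZMod 2) (J : List ι → A) {f : List ι → A}
    (hf : ∀ a z, f (a :: z) = J (a :: z) - sgn K (lp a * wp lp z) • J (z ++ [a])) (w : List ι) :
    rotSum (K := K) lp f w = 0 := by
  have h : ∀ i ∈ Finset.range w.length,
      sgn K (wp lp (w.take i) * wp lp (w.drop i)) • f (w.drop i ++ w.take i) =
      sgn K (wp lp (w.take i) * wp lp (w.drop i)) • J (w.drop i ++ w.take i) -
      sgn K (wp lp (w.take (i + 1)) * wp lp (w.drop (i + 1))) •
        J (w.drop (i + 1) ++ w.take (i + 1)) := by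
    intro i hi
    have hi' := Finset.mem_range.1 hi
    rw [← List.take_append_getElem hi', List.drop_eq_getElem_cons hi', List.cons_append, hf,
      smul_sub, smul_smul, ← sgn_add]
    congr 3
    · simp only [wp_append, wp_cons, wp_nil]
      generalize lp _ = p
      generalize wp lp (w.take i) = q
      generalize wp lp (w.drop (i + 1)) = r
      revert p q r
      decide
    · rw [List.append_assoc]
  rw [rotSum, Finset.sum_congr rfl h, Finset.sum_range_sub'
    (fun i => sgn K (wp lp (w.take i) * wp lp (w.drop i)) • J (w.drop i ++ w.take i))]
  simp [sgn_zero]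

/-- Invariance of the super trace of a word. -/
theorem loop_glVarWord (γ δ : Fin k ⊕ Fin k') (w : List ι) :
    V.loop (fun x => V.glVarWord γ δ x) (closed k k' w) = 0 := by
  simp only [glVarWord_eq_rotSum, loop_rotSum, rotSum_closed]
  refine rotSum_sub_rot V.letter (fun w => sgn K (glPar γ + glPar δ * wp V.letter w) •
    V.chain (fun y e => if e = δ then V.tWord γ δ y else 0) γ (closed k k' w)) (fun a z => ?_) w
  have h1 : V.headVar γ δ = fun x => sgn K (glPar γ + glPar δ) • V.relabel (V.tWord γ δ) γ δ x -
      V.rightMove (V.tWord γ δ) γ δ x := funext (V.headVar_eq γ δ)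
  rw [h1, loop_sub, loop_smul]
  change _ • V.loop _ ((a, none) :: closed k k' z) - V.loop _ ((a, none) :: closed k k' z) = _
  rw [loop_relabel _ _ _ _ (List.cons_ne_nil _ _), loop_rightMove, junctionSum,
    Finset.sum_eq_single γ (fun ε _ hε => by rw [if_neg hε]) (by simp), if_pos rfl, smul_smul,
    smul_smul, ← sgn_add, ← sgn_add, wp_cons, wp_closed, closed_append]
  simp only [mixedLetter, junctionPar, add_zero, wp_cons, wp_append, wp_nil]
  congr 2
  · congr 1
    generalize V.letter a = p
    generalize wp V.letter z = q
    generalize glPar γ = r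
    generalize glPar δ = s
    revert p q r s
    decide
  · congr 1
    generalize V.letter a = p
    generalize wp V.letter z = q
    generalize glPar γ = r
    generalize glPar δ = s
    revert p q r s
    decide

/-- Invariance of the super trace. -/
theorem glVar_traceHom (γ δ : Fin k ⊕ Fin k') (y : V.F) :
    V.glVar γ δ (V.traceHom k k' y) = 0 := by
  induction y using induction_words with
  | one => rw [map_one]; exact recOp_one ..
  | smul c x hx => rw [map_smul, map_smul, hx, smul_zero]
  | add x y hx hy => rw [map_add, map_add, hx, hy, add_zero]
  | mul w y hy =>
    have h1 := V.map_loop (V.glVar γ δ ∘ₗ LinearMap.mulRight K (V.traceHom k k' y))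
      (fun q => (V.tensorGL k k').cword q) (closed k k' w)
    have h2 := V.map_loop (LinearMap.mulRight K (V.inclT γ δ (V.traceHom k k' y)))
      (fun q => V.glVarWord γ δ q) (closed k k' w)
    simp only [LinearMap.comp_apply, LinearMap.mulRight_apply] at h1 h2
    rw [map_mul, ← cword, traceHom_cword, h1]
    simp only [glVar_word_mul, hy, mul_zero, add_zero]
    rw [← h2, loop_glVarWord, zero_mul]

/-! ### Contraction with the parameter -/

/-- Contraction with `t` in front: the index `α` that `t ⊗ E_{αδ}` has put on its right is changed
back to `δ`, and `t` is removed. Zero if `t` is not the first letter, if it occurs twice, or if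
the letter that follows does not have left index `α`. -/
def headContract (α δ : Fin k ⊕ Fin k') : List (Option (GlLetter ι k k')) → (V.tensorGL k k').F
  | none :: z => if ∀ a ∈ z, a.isSome then sgn K (glPar α + glPar δ) •
      V.relabel (fun x => (V.tensorGL k k').cword x) δ α (z.filterMap id) else 0
  | _ => 0

theorem relabel_hasPar (γ δ : Fin k ⊕ Fin k') (x : List (GlLetter ι k k')) :
    HasPar (wp (V.tensorGL k k').letter x + glPar γ + glPar δ + 1)
      (V.relabel (fun x => (V.tensorGL k k').cword x) γ δ x) := by
  cases x with
  | nil => exact HasPar.zero _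
  | cons x y =>
    rw [relabel]
    split_ifs with h
    · have h1 := (HasPar.word (K := K) (lp := (V.tensorGL k k').letter) ((x.1, γ, x.2.2) :: y)).smul
        (sgn K ((glPar γ + glPar δ) * (V.letter x.1 + 1)))
      convert h1 using 1
      simp only [wp_cons, tensorGL_letter, h]
      generalize V.letter x.1 = p
      generalize wp _ y = q
      generalize glPar γ = r
      generalize glPar δ = s
      generalize glPar x.2.2 = t
      revert p q r s t
      decide
    · exact HasPar.zero _

theorem extLetter_of_eq_some (γ δ : Fin k ⊕ Fin k') (a : Option (GlLetter ι k k'))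
    (b : GlLetter ι k k') (h : id a = some b) :
    (V.tensorGL k k').letter b = V.extLetter k k' γ δ a := by
  rw [id] at h
  rw [h]
  rfl

theorem headContract_hasPar (α δ : Fin k ⊕ Fin k') (u : List (Option (GlLetter ι k k'))) :
    HasPar (wp (V.extLetter k k' α δ) u + 1) (V.headContract α δ u) := by
  rcases u with _ | ⟨_ | a, z⟩
  · exact HasPar.zero _
  · rw [headContract]
    split_ifs with h
    · have h1 := (V.relabel_hasPar δ α (z.filterMap id)).smul (sgn K (glPar α + glPar δ))
      rw [wp_filterMap (V.extLetter_of_eq_some α δ) h] at h1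
      convert h1 using 1
      simp only [wp_cons, extLetter]
      ring
    · exact HasPar.zero _
  · exact HasPar.zero _

/-- The algebra map that sets `t` to zero. -/
def dropT (γ δ : Fin k ⊕ Fin k') : CycAlg K (V.extLetter k k' γ δ) →ₐ[K] (V.tensorGL k k').F :=
  restrictHom id (V.extLetter_of_eq_some γ δ) fun _ => 1

theorem dropT_word (γ δ : Fin k ⊕ Fin k') (u : List (Option (GlLetter ι k k'))) :
    V.dropT γ δ (word K _ u) =
      restrictWord K (V.tensorGL k k').letter id (fun _ => 1) u := restrictHom_word ..

/-- Contraction with `t` preserves parities. -/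
theorem rotSum_headContract_comm (α δ : Fin k ⊕ Fin k') (u v : List (Option (GlLetter ι k k'))) :
    rotSum (K := K) (V.extLetter k k' α δ) (V.headContract α δ) u * V.dropT α δ (word K _ v) =
      sgn K ((wp (V.extLetter k k' α δ) u + 1) * (wp (V.extLetter k k' α δ) v + 1)) •
        (V.dropT α δ (word K _ v) *
          rotSum (K := K) (V.extLetter k k' α δ) (V.headContract α δ) u) := by
  have h1 : HasPar (wp (V.extLetter k k' α δ) u + 1)
      (rotSum (K := K) (V.extLetter k k' α δ) (V.headContract α δ) u) := by
    refine HasPar.sum _ _ fun i _ => HasPar.smul _ ?_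
    have h2 := V.headContract_hasPar α δ (u.drop i ++ u.take i)
    rwa [wp_append, add_comm (wp _ (u.drop i)), wp_take_add_drop] at h2
  rw [dropT_word, restrictWord]
  split_ifs with hv
  · rw [one_smul, h1, wp_filterMap (V.extLetter_of_eq_some α δ) hv]
  · rw [mul_zero, zero_mul, smul_zero]

/-- The compatibility with the relations that `recOp` needs in order to define the derivation along
`φ` with values `d` on words. -/
theorem evenDerivation_rel {κ R : Type*} {lp : κ → ZMod 2} [Ring R] [Algebra K R]
    (φ : CycAlg K lp →ₐ[K] R) (d : List κ → R) (hd0 : d [] = 0)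
    (hd : ∀ a u, d (a :: u) = sgn K (lp a * wp lp u) • d (u ++ [a]))
    (hc : ∀ u v, d u * φ (word K lp v) =
      sgn K ((wp lp u + 1) * (wp lp v + 1)) • (φ (word K lp v) * d u))
    ⦃x y : FreeAlgebra K (List κ)⦄ (h : Rel K lp x y) :
    FreeAlgebra.lift K (fun w => stepOp (φ (word K lp w)) (d w) (1 : K) 0) x =
      FreeAlgebra.lift K (fun w => stepOp (φ (word K lp w)) (d w) (1 : K) 0) y := by
  refine recOp_rel (fun w => φ (word K lp w)) d (fun _ => 1) (fun _ => 0)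
    (by rw [word_nil, map_zero]) hd0 (fun _ => rfl) (fun a u => by rw [word_rot, map_smul])
    hd (fun _ _ _ => by simp) (fun _ _ => rfl)
    (fun u v => by rw [← map_mul, word_comm, map_smul, map_mul]) (fun u v y => ?_) h
  simp only [LinearMap.zero_apply, add_zero, one_smul]
  rw [← mul_assoc, hc u v, ← mul_assoc (d v), hc v u, smul_add, smul_mul_assoc, smul_mul_assoc,
    smul_smul, mul_comm (wp lp v + 1), sgn_mul_self, one_smul, add_comm, mul_assoc, mul_assoc]

/-- The even derivation along `t ↦ 0` that removes `t` from a word in which it occurs once, undoing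
the insertion of `t ⊗ E_{αδ}` on the left of a letter. -/
def contractT (α δ : Fin k ⊕ Fin k') :
    CycAlg K (V.extLetter k k' α δ) →ₗ[K] (V.tensorGL k k').F :=
  recOp (fun u => V.dropT α δ (word K _ u))
    (fun u => rotSum (K := K) (V.extLetter k k' α δ) (V.headContract α δ) u)
    (fun _ => 1) (fun _ => 0) <|
  evenDerivation_rel (V.dropT α δ) _ rfl (rotSum_rot _) (V.rotSum_headContract_comm α δ)

theorem contractT_word_mul (α δ : Fin k ⊕ Fin k') (u : List (Option (GlLetter ι k k')))
    (y : CycAlg K (V.extLetter k k' α δ)) :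
    V.contractT α δ (word K _ u * y) =
      rotSum (K := K) (V.extLetter k k' α δ) (V.headContract α δ) u * V.dropT α δ y +
        V.dropT α δ (word K _ u) * V.contractT α δ y := by
  refine (recOp_mul _ _ _ _ _ (V.dropT α δ) (fun w => rfl) u y).trans ?_
  rw [LinearMap.zero_apply, add_zero, one_smul]
  rfl

theorem contractT_mul (α δ : Fin k ⊕ Fin k') (x y : CycAlg K (V.extLetter k k' α δ)) :
    V.contractT α δ (x * y) =
      V.contractT α δ x * V.dropT α δ y + V.dropT α δ x * V.contractT α δ y := by
  have h1 : V.contractT α δ 1 = 0 := recOp_one ..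
  induction x using induction_words with
  | one => rw [h1, one_mul, map_one, one_mul, zero_mul, zero_add]
  | smul c x hx => rw [smul_mul_assoc, map_smul, hx, map_smul, map_smul, smul_mul_assoc,
      smul_mul_assoc, smul_add]
  | add a b ha hb =>
    rw [add_mul a b y, map_add, ha, hb, map_add, map_add, add_mul (V.contractT α δ a),
      add_mul (V.dropT α δ a)]
    abel
  | mul w x hx =>
    rw [mul_assoc, contractT_word_mul, hx, contractT_word_mul, map_mul, map_mul,
      mul_add (V.dropT α δ _), add_mul (_ * V.dropT α δ x)]
    simp only [mul_assoc]
    abel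

theorem contractT_word (α δ : Fin k ⊕ Fin k') (u : List (Option (GlLetter ι k k'))) :
    V.contractT α δ (word K _ u) =
      rotSum (K := K) (V.extLetter k k' α δ) (V.headContract α δ) u := by
  have h := V.contractT_word_mul α δ u 1
  rwa [mul_one, map_one, mul_one, show V.contractT α δ 1 = 0 from recOp_one .., mul_zero,
    add_zero] at h

theorem contractT_word_map_some (α δ : Fin k ⊕ Fin k') (x : List (GlLetter ι k k')) :
    V.contractT α δ (word K _ (x.map some)) = 0 := by
  rw [contractT_word]
  refine Finset.sum_eq_zero fun i hi => ?_
  rw [List.length_map] at hi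
  rw [← List.map_drop, List.drop_eq_getElem_cons (Finset.mem_range.1 hi), List.map_cons,
    List.cons_append, headContract, smul_zero]
  simp

theorem contractT_tWord (α δ : Fin k ⊕ Fin k') (x : List (GlLetter ι k k')) :
    V.contractT α δ (V.tWord α δ x) = sgn K (glPar α + glPar δ) •
      V.relabel (fun x => (V.tensorGL k k').cword x) δ α x := by
  change V.contractT α δ (word K _ (none :: x.map some)) = _
  rw [contractT_word, rotSum, List.length_cons, Finset.sum_range_succ',
    Finset.sum_eq_zero, zero_add]
  · simp [sgn_zero, headContract, List.filterMap_map]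
  · intro i hi
    rw [List.length_map] at hi
    rw [List.drop_succ_cons, ← List.map_drop, List.drop_eq_getElem_cons (Finset.mem_range.1 hi),
      List.map_cons, List.cons_append, headContract, smul_zero]
    simp

theorem contractT_inclT (α δ : Fin k ⊕ Fin k') (y : (V.tensorGL k k').F) :
    V.contractT α δ (V.inclT α δ y) = 0 := by
  induction y using induction_words with
  | one => rw [map_one]; exact recOp_one ..
  | smul c x hx => rw [map_smul, map_smul, hx, smul_zero]
  | add x y hx hy => rw [map_add, map_add, hx, hy, add_zero]
  | mul w y hy =>
    rw [map_mul, contractT_mul, hy, ← cword, inclT_word, contractT_word_map_some, zero_mul,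
      mul_zero, add_zero]

theorem dropT_inclT (α δ : Fin k ⊕ Fin k') (y : (V.tensorGL k k').F) :
    V.dropT α δ (V.inclT α δ y) = y := by
  induction y using induction_words with
  | one => rw [map_one, map_one]
  | smul c x hx => rw [map_smul, map_smul, hx]
  | add x y hx hy => rw [map_add, map_add, hx, hy]
  | mul w y hy =>
    rw [map_mul, map_mul, hy, ← cword, inclT_word, dropT, restrictHom_word, restrictWord, if_pos,
      List.filterMap_map, one_smul]
    · simp
    · intro a ha
      obtain ⟨b, -, rfl⟩ := List.mem_map.1 ha
      rfl

theorem dropT_glVarWord (α δ : Fin k ⊕ Fin k') (w : List (GlLetter ι k k')) :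
    V.dropT α δ (V.glVarWord α δ w) = 0 := by
  rw [glVarWord_eq_rotSum]
  have h : ∀ x, V.dropT α δ (V.headVar α δ x) = 0 := by
    intro x
    have h1 : ∀ z, V.dropT α δ (V.tWord α δ z) = 0 := by
      intro z
      change V.dropT α δ (word K _ (none :: z.map some)) = 0
      rw [dropT, restrictHom_word, restrictWord, if_neg (by simp)]
    rw [headVar_eq, map_sub, map_smul]
    cases x with
    | nil => simp [relabel, rightMove]
    | cons x y =>
      rw [relabel, rightMove]
      split_ifs <;> simp only [map_smul, h1, map_zero, smul_zero, sub_zero]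
  refine (rotSum_map (V.dropT α δ).toLinearMap _ _).trans ?_
  simp [h, rotSum]

end symmetry

/-! ### The derivation that counts open junctions -/

section invariants

variable {K : Type*} [Field K] {ι : Type*} {k k' : ℕ} (V : EvenScalarSpace K ι)
  {A : Type*} [AddCommGroup A] [Module K A]

/-- The even derivation `∑_δ contractT α δ ∘ glVar α δ`. It counts the junctions that are not
closed, see `openCount_loop`. -/
def openCount (α : Fin k ⊕ Fin k') : (V.tensorGL k k').F →ₗ[K] (V.tensorGL k k').F :=
  ∑ δ, V.contractT α δ ∘ₗ V.glVar α δ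

theorem openCount_apply (α : Fin k ⊕ Fin k') (y : (V.tensorGL k k').F) :
    V.openCount α y = ∑ δ, V.contractT α δ (V.glVar α δ y) := by
  simp [openCount, LinearMap.sum_apply]

theorem openCount_one (α : Fin k ⊕ Fin k') : V.openCount α 1 = 0 := by
  rw [openCount_apply]
  refine Finset.sum_eq_zero fun δ _ => ?_
  rw [show V.glVar α δ 1 = 0 from recOp_one .., map_zero]

theorem openCount_traceHom (α : Fin k ⊕ Fin k') (y : V.F) :
    V.openCount α (V.traceHom k k' y) = 0 := by
  rw [openCount_apply]
  refine Finset.sum_eq_zero fun δ _ => ?_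
  rw [glVar_traceHom, map_zero]

theorem openCount_cword_mul (α : Fin k ⊕ Fin k') (w : List (GlLetter ι k k'))
    (y : (V.tensorGL k k').F) :
    V.openCount α ((V.tensorGL k k').cword w * y) =
      (∑ δ, V.contractT α δ (V.glVarWord α δ w)) * y +
        (V.tensorGL k k').cword w * V.openCount α y := by
  rw [openCount_apply, openCount_apply, Finset.sum_mul, Finset.mul_sum, ← Finset.sum_add_distrib]
  refine Finset.sum_congr rfl fun δ _ => ?_
  rw [glVar_word_mul, map_add, contractT_mul, contractT_mul, contractT_inclT, contractT_inclT,
    dropT_inclT, dropT_inclT, dropT_glVarWord, zero_mul, zero_mul, add_zero, zero_add]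

theorem openCount_cword (α : Fin k ⊕ Fin k') (w : List (GlLetter ι k k')) :
    V.openCount α ((V.tensorGL k k').cword w) = ∑ δ, V.contractT α δ (V.glVarWord α δ w) := by
  have h := V.openCount_cword_mul α w 1
  rwa [mul_one, mul_one, openCount_one, mul_zero, add_zero] at h

theorem openCount_mul (α : Fin k ⊕ Fin k') (x y : (V.tensorGL k k').F) :
    V.openCount α (x * y) = V.openCount α x * y + x * V.openCount α y := by
  induction x using induction_words with
  | one => rw [one_mul, openCount_one, zero_mul, zero_add, one_mul]
  | smul c x hx => rw [smul_mul_assoc, map_smul, hx, map_smul, smul_mul_assoc, smul_mul_assoc,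
      smul_add]
  | add a b ha hb =>
    rw [add_mul a b y, map_add, ha, hb, map_add, add_mul (V.openCount α a), add_mul a b]
    abel
  | mul w x hx =>
    rw [mul_assoc, ← cword, openCount_cword_mul, hx, openCount_cword_mul,
      mul_add _ (V.openCount α x * y), add_mul _ _ y]
    simp only [mul_assoc]
    abel

/-- The contribution to `openCount` of the commutators with the first letter. -/
def headOpen (α : Fin k ⊕ Fin k') (x : List (GlLetter ι k k')) : (V.tensorGL k k').F :=
  ∑ δ, V.contractT α δ (V.headVar α δ x)

theorem openCount_cword_eq_rotSum (α : Fin k ⊕ Fin k') (w : List (GlLetter ι k k')) :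
    V.openCount α ((V.tensorGL k k').cword w) =
      rotSum (K := K) (V.tensorGL k k').letter (V.headOpen α) w := by
  rw [openCount_cword]
  simp only [glVarWord_eq_rotSum, rotSum_map]
  simp only [rotSum]
  rw [Finset.sum_comm]
  exact Finset.sum_congr rfl fun i _ => Finset.smul_sum.symm

/-- Contraction undoes the insertion of `t` on the left of the first letter. -/
theorem contractT_relabel_tWord (α δ : Fin k ⊕ Fin k') (x : List (GlLetter ι k k')) :
    V.contractT α δ (sgn K (glPar α + glPar δ) • V.relabel (V.tWord α δ) α δ x) =
      match x with
      | [] => 0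
      | x :: y => if x.2.1 = δ then (V.tensorGL k k').cword (x :: y) else 0 := by
  cases x with
  | nil => simp [relabel]
  | cons x y =>
    rw [map_smul]
    simp only [relabel]
    split_ifs with h
    · rw [map_smul, contractT_tWord]
      simp only [relabel, if_true]
      rw [smul_smul, smul_smul, smul_smul, ← h]
      refine Eq.trans (congrArg (· • _) ?_) (one_smul K _)
      rw [← sgn_add, ← sgn_add, ← sgn_add]
      refine Eq.trans (congrArg (sgn K) ?_) (sgn_zero K)
      generalize V.letter x.1 = p
      generalize glPar α = q
      generalize glPar x.2.1 = r
      revert p q r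
      decide
    · rw [map_zero, smul_zero]

theorem headOpen_eq (α : Fin k ⊕ Fin k') (x : List (GlLetter ι k k')) :
    V.headOpen α x = (V.tensorGL k k').cword x -
      ∑ δ, V.rightMove (fun z => V.contractT α δ (V.tWord α δ z)) α δ x := by
  have h : ∀ δ, V.contractT α δ (V.headVar α δ x) =
      V.contractT α δ (sgn K (glPar α + glPar δ) • V.relabel (V.tWord α δ) α δ x) -
      V.rightMove (fun z => V.contractT α δ (V.tWord α δ z)) α δ x := by
    intro δ
    rw [headVar_eq, map_sub]
    congr 1
    cases x with
    | nil => exact map_zero _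
    | cons x y =>
      simp only [rightMove]
      split_ifs
      · rw [map_smul]
      · rw [map_zero]
  rw [headOpen, Finset.sum_congr rfl fun δ _ => h δ, Finset.sum_sub_distrib]
  congr 1
  simp only [contractT_relabel_tWord]
  cases x with
  | nil => simp [word_nil]
  | cons x y => simp

/-- The coefficient at `(α, α)` of a junction, the closed junction being the sum of all `(δ, δ)`. -/
def diagCoeff (K : Type*) [Field K] (α : Fin k ⊕ Fin k') : Junction k k' → K
  | none => 1
  | some p => if p = (α, α) then 1 else 0

theorem junctionSum_diag (α : Fin k ⊕ Fin k') (j : Junction k k') (a : A) :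
    junctionSum j (fun ε β => if ε = α then if β = α then a else 0 else 0) =
      diagCoeff K α j • a := by
  rcases j with _ | ⟨p, q⟩
  · simp [junctionSum, diagCoeff]
  · by_cases hp : p = α <;> by_cases hq : q = α <;> simp [junctionSum, diagCoeff, hp, hq]

/-- Insertion of `t` on the right of a letter followed by contraction closes the next junction. -/
theorem loop_rightMove_contract (α : Fin k ⊕ Fin k') (x : ι × Junction k k')
    (l : List (ι × Junction k k')) :
    ∑ δ, V.loop (V.rightMove (fun z => V.contractT α δ (V.tWord α δ z)) α δ) (x :: l) =
      diagCoeff K α x.2 •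
        V.loop (fun z => (V.tensorGL k k').cword z) ((x.1, none) :: l) := by
  have h3 : ∀ δ β : Fin k ⊕ Fin k',
      V.chain (fun y e => if e = δ then V.contractT α δ (V.tWord α δ y) else 0) β
        (l ++ [(x.1, none)]) = if β = α then sgn K (glPar α + glPar δ) •
        V.chain (fun y e => if e = δ then (V.tensorGL k k').cword y else 0) δ
          (l ++ [(x.1, none)]) else 0 := by
    intro δ β
    have h := V.chain_relabel (fun z => (V.tensorGL k k').cword z) δ α δ β
      (l := l ++ [(x.1, none)]) (by simp)
    rw [← smul_ite_zero, ← h, ← chain_smul]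
    simp only [contractT_tWord, smul_ite_zero]
  have h4 := V.loop_append (f := fun z => (V.tensorGL k k').cword z) V.cword_tensorGL_append
    [(x.1, none)] l
  rw [List.singleton_append] at h4
  rw [h4]
  refine Eq.trans ?_ (junctionSum_diag (K := K) (A := (V.tensorGL k k').F) α x.2 _)
  simp only [loop_rightMove, h3]
  rw [sum_junctionSum]
  refine junctionSum_congr fun ε β hj => ?_
  by_cases hε : ε = α
  swap
  · simp [hε]
  by_cases hβ : β = α
  swap
  · simp [hβ]
  subst hε
  subst hβ
  simp only [if_true]
  rw [loop, Finset.smul_sum]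
  refine Finset.sum_congr rfl fun δ _ => ?_
  rw [smul_smul, smul_smul, ← sgn_add, ← sgn_add]
  congr 2
  have h5 : wp (V.mixedLetter k k') [(x.1, none)] = V.letter x.1 := by
    simp [mixedLetter, junctionPar]
  have h6 : V.mixedLetter k k' x = V.letter x.1 := by
    rw [mixedLetter, ← hj, CharTwo.add_self_eq_zero, add_zero]
  rw [wp_append, wp_cons, h5, h6]
  generalize V.letter x.1 = p
  generalize wp _ l = q
  generalize glPar β = r
  generalize glPar δ = s
  revert p q r s
  decide

/-- At the first junction, `openCount` subtracts from a junction the closed one, with the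
coefficient at `(α, α)`. -/
theorem loop_headOpen (α : Fin k ⊕ Fin k') (x : ι × Junction k k')
    (l : List (ι × Junction k k')) :
    V.loop (V.headOpen α) (x :: l) = V.loop (fun z => (V.tensorGL k k').cword z) (x :: l) -
      diagCoeff K α x.2 • V.loop (fun z => (V.tensorGL k k').cword z) ((x.1, none) :: l) := by
  rw [← loop_rightMove_contract, ← loop_sum, ← loop_sub]
  congr 1
  funext z
  exact V.headOpen_eq α z

/-- If every junction is closed or different from `(α, α)`, the word is an eigenvector of
`openCount α` with eigenvalue the number of junctions that are not closed. -/
theorem openCount_loop (α : Fin k ⊕ Fin k') (l : List (ι × Junction k k'))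
    (hl : ∀ x ∈ l, x.2 ≠ some (α, α)) :
    V.openCount α (V.loop (fun z => (V.tensorGL k k').cword z) l) =
      (l.countP (fun x => x.2.isSome) : K) • V.loop (fun z => (V.tensorGL k k').cword z) l := by
  rw [map_loop]
  simp only [openCount_cword_eq_rotSum]
  rw [loop_rotSum, rotSum]
  have h : ∀ i ∈ Finset.range l.length,
      sgn K (wp (V.mixedLetter k k') (l.take i) * wp (V.mixedLetter k k') (l.drop i)) •
        V.loop (V.headOpen α) (l.drop i ++ l.take i) =
      (((l.take (i + 1)).countP (fun x => x.2.isSome) : K) -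
        ((l.take i).countP (fun x => x.2.isSome) : K)) •
          V.loop (fun z => (V.tensorGL k k').cword z) l := by
    intro i hi
    have hi' := Finset.mem_range.1 hi
    have h1 := V.loop_append (f := fun z => (V.tensorGL k k').cword z) V.cword_tensorGL_append
      (l.take i) (l.drop i)
    rw [List.take_append_drop] at h1
    rw [← List.take_append_getElem hi', List.countP_append, h1, List.drop_eq_getElem_cons hi',
      List.cons_append, loop_headOpen]
    have h2 := hl l[i] (List.getElem_mem hi')
    rcases hx : l[i] with ⟨a, _ | p⟩
    · simp [diagCoeff]
    · rw [hx] at h2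
      have h4 : p ≠ (α, α) := fun h => h2 (by rw [h])
      simp [diagCoeff, h4]
  rw [Finset.sum_congr rfl h, ← Finset.sum_smul, Finset.sum_range_sub
    (fun i => ((l.take i).countP (fun x => x.2.isSome) : K))]
  simp

/-- The sum of the traces and of the eigenspaces of `openCount α` with eigenvalue `1, 2, …`. -/
def eigenSum (α : Fin k ⊕ Fin k') : Submodule K (V.tensorGL k k').F :=
  LinearMap.range (V.traceHom k k').toLinearMap ⊔
    ⨆ n : ℕ, Module.End.eigenspace (V.openCount α) ((n : K) + 1)

/-- By induction on the number of junctions `(α, α)`, which are replaced by the closed junction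
minus all other `(δ, δ)`. -/
theorem loop_mem_eigenSum (α : Fin k ⊕ Fin k') : ∀ (m : ℕ) (l : List (ι × Junction k k')),
    l.countP (fun x => x.2 = some (α, α)) = m →
    V.loop (fun z => (V.tensorGL k k').cword z) l ∈ V.eigenSum α := by
  intro m
  induction m with
  | zero =>
    intro l hl
    have hl' : ∀ x ∈ l, x.2 ≠ some (α, α) := by
      intro x hx
      simpa using List.countP_eq_zero.1 hl x hx
    have h := V.openCount_loop α l hl'
    cases hc : l.countP (fun x => x.2.isSome) with
    | zero =>
      have h1 : l = closed k k' (l.map Prod.fst) := by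
        rw [closed, List.map_map]
        refine (List.map_id l).symm.trans (List.map_congr_left fun x hx => ?_)
        have h2 := List.countP_eq_zero.1 hc x hx
        rcases x with ⟨a, _ | p⟩
        · rfl
        · simp at h2
      rw [h1, ← traceHom_cword]
      exact Submodule.mem_sup_left ⟨_, rfl⟩
    | succ n =>
      refine Submodule.mem_sup_right (Submodule.mem_iSup_of_mem n ?_)
      rw [Module.End.mem_eigenspace_iff, h, hc, Nat.cast_succ]
  | succ m ih =>
    intro l hl
    obtain ⟨x, hx, hx'⟩ : ∃ x ∈ l, x.2 = some (α, α) := by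
      have := List.countP_pos_iff.1 (hl.symm ▸ Nat.succ_pos m :
        0 < l.countP fun x => x.2 = some (α, α))
      simpa using this
    obtain ⟨u, v, rfl⟩ := List.append_of_mem hx
    obtain ⟨a, j⟩ := x
    simp only at hx'
    subst hx'
    rw [V.loop_append V.cword_tensorGL_append, List.cons_append]
    refine Submodule.smul_mem _ _ ?_
    have hcount : (v ++ u).countP (fun x => x.2 = some (α, α)) = m := by
      simp [List.countP_append] at hl ⊢
      omega
    have h1 : V.loop (fun z => (V.tensorGL k k').cword z) ((a, some (α, α)) :: (v ++ u)) =
        V.loop (fun z => (V.tensorGL k k').cword z) ((a, none) :: (v ++ u)) -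
        ∑ δ ∈ Finset.univ.erase α,
          V.loop (fun z => (V.tensorGL k k').cword z) ((a, some (δ, δ)) :: (v ++ u)) := by
      -- `(δ, δ)` and the closed junction are both even, hence all terms have the same sign.
      rw [eq_sub_iff_add_eq, Finset.add_sum_erase _ (fun δ => V.loop
        (fun z => (V.tensorGL k k').cword z) ((a, some (δ, δ)) :: (v ++ u))) (Finset.mem_univ α)]
      simp only [loop]
      rw [Finset.sum_comm]
      refine Finset.sum_congr rfl fun β _ => ?_
      simp only [chain_cons, junctionSum, wp_cons, mixedLetter, junctionPar,
        CharTwo.add_self_eq_zero, Finset.smul_sum]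
    rw [h1]
    refine Submodule.sub_mem _ (ih _ ?_) (Submodule.sum_mem _ fun δ hδ => ih _ ?_)
    · rw [List.countP_cons, hcount]
      simp
    · rw [List.countP_cons, hcount]
      have := (Finset.mem_erase.1 hδ).1
      simp [this]

/-- The left index of the first letter of a word, and `b` if the word is empty. -/
def headIndex (b : Fin k ⊕ Fin k') : List (GlLetter ι k k') → Fin k ⊕ Fin k'
  | [] => b
  | x :: _ => x.2.1

/-- The letters of a word with all junctions as they are in the word, the last one leading to
`b`. -/
def openJunctions (b : Fin k ⊕ Fin k') : List (GlLetter ι k k') → List (ι × Junction k k')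
  | [] => []
  | x :: y => (x.1, some (x.2.2, headIndex b y)) :: openJunctions b y

/-- Every word is, up to sign, the only word with its letters and junctions. -/
theorem chain_openJunctions (b : Fin k ⊕ Fin k') (w : List (GlLetter ι k k')) :
    ∀ (f : List (GlLetter ι k k') → (Fin k ⊕ Fin k') → A),
    ∃ e : ZMod 2, V.chain f (headIndex b w) (openJunctions b w) = sgn K e • f w b := by
  induction w with
  | nil => exact fun f => ⟨0, by simp [openJunctions, headIndex, chain, sgn_zero]⟩
  | cons x w ih =>
    intro f
    obtain ⟨e, he⟩ := ih fun y e => f (x :: y) e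
    refine ⟨(V.letter x.1 + 1) * glPar x.2.1 + e, ?_⟩
    rw [sgn_add, mul_smul, ← he]
    rfl

/-- Every path along the junctions of a nonempty word ends at `b`. -/
theorem chain_openJunctions_eq_zero (b : Fin k ⊕ Fin k') (w : List (GlLetter ι k k')) :
    ∀ (f : List (GlLetter ι k k') → (Fin k ⊕ Fin k') → A) (β : Fin k ⊕ Fin k'),
    (∀ y, f y b = 0) → (w = [] → β = b) → V.chain f β (openJunctions b w) = 0 := by
  induction w with
  | nil => intro f β h hβ; rw [hβ rfl]; exact h []
  | cons x w ih =>
    intro f β h _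
    rw [openJunctions, chain_cons, junctionSum, ih _ _ (fun y => h _), smul_zero]
    rintro rfl
    rfl

theorem cword_mem_eigenSum (α : Fin k ⊕ Fin k') (w : List (GlLetter ι k k')) :
    (V.tensorGL k k').cword w ∈ V.eigenSum α := by
  cases w with
  | nil => rw [show (V.tensorGL k k').cword [] = 0 from word_nil]; exact Submodule.zero_mem _
  | cons x y =>
    obtain ⟨e, he⟩ := V.chain_openJunctions x.2.1 (x :: y) fun z e =>
      if e = x.2.1 then (V.tensorGL k k').cword z else 0
    have h := V.loop_mem_eigenSum α _ (openJunctions x.2.1 (x :: y)) rfl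
    rw [loop, Finset.sum_eq_single x.2.1 (fun β _ hβ => ?_) (by simp)] at h
    · change V.chain _ x.2.1 _ = _ at he
      rw [he, if_pos rfl, smul_smul, ← sgn_add] at h
      have h1 := Submodule.smul_mem _ (sgn K (glPar x.2.1 *
        (wp (V.mixedLetter k k') (openJunctions x.2.1 (x :: y)) + 1) + e)) h
      rwa [smul_smul, sgn_mul_self, one_smul] at h1
    · rw [chain_openJunctions_eq_zero, smul_zero]
      · exact fun y => if_neg hβ.symm
      · simp

/-- Eigenspaces of a derivation multiply, and the eigenvalues add. -/
theorem mul_mem_eigenSum (α : Fin k ⊕ Fin k') {x y : (V.tensorGL k k').F}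
    (hx : x ∈ V.eigenSum α) (hy : y ∈ V.eigenSum α) : x * y ∈ V.eigenSum α := by
  have h : V.eigenSum α * V.eigenSum α ≤ V.eigenSum α := by
    have e1 : ∀ n : ℕ, Module.End.eigenspace (V.openCount α) ((n : K) + 1) ≤ V.eigenSum α :=
      fun n => (le_iSup (fun n : ℕ => Module.End.eigenspace (V.openCount α) ((n : K) + 1)) n).trans
        le_sup_right
    conv_lhs => rw [eigenSum]
    rw [Submodule.sup_mul, Submodule.mul_sup, Submodule.mul_sup, Submodule.iSup_mul,
      Submodule.mul_iSup, Submodule.iSup_mul]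
    simp only [Submodule.mul_iSup]
    refine sup_le (sup_le ?_ (iSup_le fun n => ?_)) (sup_le (iSup_le fun n => ?_)
      (iSup_le fun n => iSup_le fun m => ?_))
    · rw [Submodule.mul_le]
      rintro _ ⟨a, rfl⟩ _ ⟨b, rfl⟩
      exact Submodule.mem_sup_left ⟨a * b, map_mul (V.traceHom k k') a b⟩
    · refine le_trans ?_ (e1 n)
      rw [Submodule.mul_le]
      rintro _ ⟨a, rfl⟩ b hb
      rw [Module.End.mem_eigenspace_iff] at hb ⊢
      rw [openCount_mul, hb, AlgHom.toLinearMap_apply, openCount_traceHom, zero_mul, zero_add,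
        mul_smul_comm]
    · refine le_trans ?_ (e1 n)
      rw [Submodule.mul_le]
      rintro a ha _ ⟨b, rfl⟩
      rw [Module.End.mem_eigenspace_iff] at ha ⊢
      rw [openCount_mul, ha, AlgHom.toLinearMap_apply, openCount_traceHom, mul_zero, add_zero,
        smul_mul_assoc]
    · refine le_trans ?_ (e1 (n + m + 1))
      rw [Submodule.mul_le]
      intro a ha b hb
      rw [Module.End.mem_eigenspace_iff] at ha hb ⊢
      rw [openCount_mul, ha, hb, smul_mul_assoc, mul_smul_comm, ← add_smul]
      congr 1
      push_cast
      ring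
  exact h (Submodule.mul_mem_mul hx hy)

theorem mem_eigenSum (α : Fin k ⊕ Fin k') (x : (V.tensorGL k k').F) : x ∈ V.eigenSum α := by
  induction x using induction_words with
  | one => exact Submodule.mem_sup_left ⟨1, map_one (V.traceHom k k')⟩
  | smul c x hx => exact Submodule.smul_mem _ c hx
  | add x y hx hy => exact Submodule.add_mem _ hx hy
  | mul w x hx => exact V.mul_mem_eigenSum α (V.cword_mem_eigenSum α w) hx

/-- The kernel of `openCount α` consists of traces. -/
theorem mem_range_of_openCount_eq_zero [CharZero K] (α : Fin k ⊕ Fin k')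
    {x : (V.tensorGL k k').F} (hx : V.openCount α x = 0) :
    ∃ y, V.traceHom k k' y = x := by
  obtain ⟨_, ⟨y, rfl⟩, z, hz, rfl⟩ := Submodule.mem_sup.1 (V.mem_eigenSum α x)
  rw [AlgHom.toLinearMap_apply, map_add, openCount_traceHom, zero_add] at hx
  -- `z` lies in the eigenspace of zero and in the sum of the other eigenspaces.
  have hd := (Module.End.eigenspaces_iSupIndep (V.openCount α)) 0
  have hz' : z = 0 := by
    refine (Submodule.disjoint_def.1 hd) z ?_ ?_
    · rw [Module.End.mem_eigenspace_iff, hx, zero_smul]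
    · exact (iSup_le fun n : ℕ => le_iSup₂_of_le (f := fun (c : K) (_ : c ≠ 0) =>
        Module.End.eigenspace (V.openCount α) c) ((n : K) + 1) (Nat.cast_add_one_ne_zero n)
        le_rfl) hz
  exact ⟨y, by rw [hz', add_zero]; rfl⟩

end invariants

/-! ### Symmetric solutions -/

section symmetricSolutions

variable {K : Type*} [Field K] {ι : Type*} {k k' : ℕ} (V : EvenScalarSpace K ι)

theorem map_diagHom_of_map_traceHom (α : Fin k ⊕ Fin k') (S : V.F⟦X⟧) :
    PowerSeries.map (V.diagHom α : (V.tensorGL k k').F →+* V.F)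
      (PowerSeries.map (V.traceHom k k' : V.F →+* (V.tensorGL k k').F) S) = S := by
  ext n
  rw [PowerSeries.coeff_map, PowerSeries.coeff_map]
  exact V.diagHom_traceHom α _

/-- A symmetric series is the trace of the series that `diagHom` extracts from it. -/
theorem IsGlSymmetric.map_diagHom [CharZero K] {T : (V.tensorGL k k').F⟦X⟧}
    (hT : V.IsGlSymmetric T) (α : Fin k ⊕ Fin k') :
    PowerSeries.map (V.traceHom k k' : V.F →+* (V.tensorGL k k').F)
      (PowerSeries.map (V.diagHom α : (V.tensorGL k k').F →+* V.F) T) = T := by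
  ext n
  rw [PowerSeries.coeff_map, PowerSeries.coeff_map]
  obtain ⟨y, hy⟩ := V.mem_range_of_openCount_eq_zero α (x := PowerSeries.coeff n T) (by
    rw [openCount_apply]
    exact Finset.sum_eq_zero fun δ _ => by rw [hT α δ n, map_zero])
  rw [← hy]
  exact congrArg (V.traceHom k k') (V.diagHom_traceHom α y)

theorem IsSolution.of_map_traceHom (α : Fin k ⊕ Fin k') {S : V.F⟦X⟧}
    (hS : (V.tensorGL k k').IsSolution
      (PowerSeries.map (V.traceHom k k' : V.F →+* (V.tensorGL k k').F) S)) : V.IsSolution S := by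
  change V.master S = 0
  change (V.tensorGL k k').master _ = 0 at hS
  rw [← map_master] at hS
  rw [← V.map_diagHom_of_map_traceHom α (V.master S), hS, map_zero]

theorem IsEven.map_diagHom (α : Fin k ⊕ Fin k') {T : (V.tensorGL k k').F⟦X⟧}
    (hT : (V.tensorGL k k').IsEven T) :
    V.IsEven (PowerSeries.map (V.diagHom α : (V.tensorGL k k').F →+* V.F) T) := by
  intro n
  rw [PowerSeries.coeff_map]
  exact (V.diagHom_parityInv α _).symm.trans (congrArg _ (hT n))

theorem IsGlSymmetric.of_map_traceHom (S : V.F⟦X⟧) :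
    V.IsGlSymmetric (PowerSeries.map (V.traceHom k k' : V.F →+* (V.tensorGL k k').F) S) := by
  intro γ δ n
  rw [PowerSeries.coeff_map]
  exact V.glVar_traceHom γ δ _

/-- If `k = k' = 0` there are no letters, so that there are only constants. -/
theorem exists_algebraMap_eq [IsEmpty (Fin k ⊕ Fin k')] (x : (V.tensorGL k k').F) :
    ∃ c : K, algebraMap K (V.tensorGL k k').F c = x := by
  induction x using induction_words with
  | one => exact ⟨1, map_one _⟩
  | smul c x hx =>
    obtain ⟨d, rfl⟩ := hx
    exact ⟨c * d, by rw [map_mul, Algebra.smul_def]⟩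
  | add x y hx hy =>
    obtain ⟨c, rfl⟩ := hx
    obtain ⟨d, rfl⟩ := hy
    exact ⟨c + d, map_add _ _ _⟩
  | mul w x hx =>
    cases w with
    | nil => exact ⟨0, by rw [word_nil, zero_mul, map_zero]⟩
    | cons a w => exact isEmptyElim a.2.1

theorem bv_algebraMap (c : K) : V.bv (algebraMap K V.F c) = 0 := by
  rw [Algebra.algebraMap_eq_smul_one, map_smul, bv_one, smul_zero]

theorem isSolution_of_algebraMap (c : ℕ → K) :
    V.IsSolution (PowerSeries.mk fun n => algebraMap K V.F (c n)) := by
  have h1 : V.bvSeries (PowerSeries.mk fun n => algebraMap K V.F (c n)) = 0 := by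
    ext n
    rw [bvSeries, PowerSeries.coeff_mk, PowerSeries.coeff_mk, bv_algebraMap, map_zero]
  have h2 : V.bracketSeries (PowerSeries.mk fun n => algebraMap K V.F (c n))
      (PowerSeries.mk fun n => algebraMap K V.F (c n)) = 0 := by
    ext n
    rw [bracketSeries, PowerSeries.coeff_mk, map_zero]
    refine Finset.sum_eq_zero fun p _ => ?_
    rw [PowerSeries.coeff_mk, PowerSeries.coeff_mk, bracket, AlgHom.commutes, ← map_mul,
      bv_algebraMap, bv_algebraMap, bv_algebraMap, zero_mul, mul_zero, sub_zero, sub_zero]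
  rw [IsSolution, h1, h2, mul_zero, smul_zero, add_zero]

theorem isEven_of_algebraMap (c : ℕ → K) :
    V.IsEven (PowerSeries.mk fun n => algebraMap K V.F (c n)) := by
  intro n
  rw [PowerSeries.coeff_mk, AlgHom.commutes]

end symmetricSolutions

end EvenScalarSpace

end NCBV

theorem mainTheorem9 {K : Type*} [Field K] [CharZero K] {ι : Type*}
    (V : NCBV.EvenScalarSpace K ι) (k k' : ℕ) :
    ∃ M : V.F →ₐ[K] (V.tensorGL k k').F,
      (∀ w : List ι, M (V.cword w) = V.traceWord k k' w) ∧
      (∀ S : V.F⟦X⟧, V.IsSolution S →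
        (V.tensorGL k k').IsSolution (PowerSeries.map (M : V.F →+* (V.tensorGL k k').F) S)) ∧
      (∀ S : V.F⟦X⟧, V.IsEven S →
        (V.tensorGL k k').IsEven (PowerSeries.map (M : V.F →+* (V.tensorGL k k').F) S)) ∧
      (∀ T : (V.tensorGL k k').F⟦X⟧, (V.tensorGL k k').IsSolution T →
        (V.IsGlSymmetric T ↔
          ∃ S : V.F⟦X⟧, V.IsSolution S ∧ ((V.tensorGL k k').IsEven T → V.IsEven S) ∧
            PowerSeries.map (M : V.F →+* (V.tensorGL k k').F) S = T)) := by
  refine ⟨V.traceHom k k', fun w => (V.traceHom_cword w).trans (V.traceWord_eq_loop w).symm,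
    fun S hS => hS.map_traceHom, fun S hS => hS.map_traceHom, fun T hT => ⟨fun h => ?_, ?_⟩⟩
  · rcases isEmpty_or_nonempty (Fin k ⊕ Fin k') with hn | ⟨⟨α⟩⟩
    · -- All words of `F(V ⊗ gl(0|0))` vanish, and constant series are solutions.
      choose c hc using fun n => V.exists_algebraMap_eq (PowerSeries.coeff n T)
      refine ⟨PowerSeries.mk fun n => algebraMap K V.F (c n), V.isSolution_of_algebraMap c,
        fun _ => V.isEven_of_algebraMap c, ?_⟩
      ext n
      rw [PowerSeries.coeff_map, PowerSeries.coeff_mk, ← hc n]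
      exact (V.traceHom k k').commutes _
    · have h1 := h.map_diagHom V α
      exact ⟨_, NCBV.EvenScalarSpace.IsSolution.of_map_traceHom V α (h1.symm ▸ hT),
        fun hE => hE.map_diagHom V α, h1⟩
  · rintro ⟨S, -, -, rfl⟩
    exact NCBV.EvenScalarSpace.IsGlSymmetric.of_map_traceHom V S
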